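/- **Setting.** Fix $d\ge 1$ and $n$. For every even $L\ge 2$ let $\Lambda=\Lambda_L=(\mathbb Z/L\mathbb Z)^d$ with its nearest-neighbour graph distance, where $\mathbb Z/L\mathbb Z$ is identified with $\{-L/2+1,\dots,L/2\}$. Consider either * (spins) $\mathcal H=\bigotimes_{x\in\Lambda}\mathbb C^n$, with $\mathcal A_X$, for $X\subset\Lambda$, the set of operators $O_X\otimes 1_{\Lambda\setminus X}$; or * (fermions) $\mathcal H$ the antisymmetric Fock space over $\ell^2(\Lambda,\mathbb C^n)$, with $\mathcal A_X$ the algebra generated by the monomials of even degree in the operators $c_{x,\sigma},c^*_{x,\sigma}$, $x\in X$, $\sigma=1,\dots,n$. Put $\mathcal A=\mathcal A_\Lambda$. For a region $X$ and $r\ge 0$ let $X^r=\{x\in\Lambda:\mathrm{dist}(x,X)\le r\}$. Let $\Gamma=\{0\le x_1<L/2\}$, $\partial_-=\{x_1=0\}$, $\partial_+=\{x_1=L/2-1\}$, $S_-=\{|x_1|\le L/8\}$, $S_+=\{|x_1-L/2|\le L/8\}$ (the difference $x_1-L/2$ taken modulo $L$), and let $d_1(X,X')$ be the minimal distance, on the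 circle $\mathbb Z/L\mathbb Z$, between the first coordinates of points of $X$ and of $X'$. All objects below are families indexed by even $L\ge2$, and all constants are independent of $L$. We write $f=\mathcal O(L^{-\infty})$ if for every $k\in\mathbb N$ there is $C_k$ with $|f(L)|\le C_kL^{-k}$ for all $L$. A state is a unit vector $\Omega\in\mathcal H$, and $\mathrm{Var}_\Omega(A)=\|(A-\langle\Omega,A\Omega\rangle)\Omega\|^2$. Let $Q_x=Q_x^*\in\mathcal A_{\{x\}}$ with $\mathrm{Spec}(Q_x)\subset\mathbb Z$ for all $x\in\Lambda$, and let $Q=\sum_{x\in\Gamma}Q_x$. Let $U\in\mathcal A$ be unitary and let $\Omega$ be a state such that: 1. ($U$ is almost local) there are constants $C_k$, $k\in\mathbb N$, such that for all $L$, all $X\subset\Lambda$, all $A\in\mathcal A_X$ and all $r\in\mathbb N$ there is $R_r\in\mathcal A_{X^r}$ with $r^k\,\|U^*AU-R_r\|\le C_k\|A\|\,|X|$ for all $k$; 2. (local charge conservation) there are self-adjoint $T_\pm\in\mathcal A_{S_\pm}$ with $\|(U^*QU-Q)-T_--T_+\|=\mathcal O(L^{-\infty})$; 3. ($U$-invariance)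 $\mathrm{Var}_\Omega(U)=\mathcal O(L^{-\infty})$; 4. (local charge fluctuations) there are self-adjoint $K_\pm\in\mathcal A_{\partial_\pm^{L/16}}$ with $\|K_\pm\|\le C|\Lambda|$ and $\mathrm{Var}_\Omega(Q-K_--K_+)=\mathcal O(L^{-\infty})$; 5. (clustering in the $x_1$-direction) there are $c,C\in(0,\infty)$ such that for all $L$, all $X,X'\subset\Lambda$, all $A\in\mathcal A_X$ and $B\in\mathcal A_{X'}$, $$|\langle\Omega,AB\,\Omega\rangle-\langle\Omega,A\Omega\rangle\langle\Omega,B\Omega\rangle|\le C\|A\|\|B\|\,|X|\,|X'|\,e^{-c\,d_1(X,X')}.$$ **Theorem.** If the operators $T_\pm$ in (2) are chosen such that in addition $$\big\|e^{2\pi i(Q+T_-)}-1\big\|=\mathcal O(L^{-\infty}),\qquad \|T_\pm\|\le C|\Lambda|,$$ then $\langle\Omega,T_-\Omega\rangle$ lies within $\mathcal O(L^{-\infty})$ of an integer: there are $\varepsilon_L=\mathcal O(L^{-\infty})$ such that for every even $L\ge2$ there is $m\in\mathbb Z$ with $|\langle\Omega,T_-\Omega\rangle-m|\le\varepsilon_L$.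 -/

import Mathlib

open scoped Matrix

namespace ManyBodyIndex

noncomputable section

/-! ### The discrete torus -/

/-- The admissible side lengths of the torus: positive even integers. -/
abbrev EvenSize : Type := {L : ℕ // 0 < L ∧ Even L}

instance instNeZeroEvenSize (L : EvenSize) : NeZero L.1 := ⟨L.2.1.ne'⟩

/-- The discrete `d`-torus `(ℤ/Lℤ)^d`. -/
abbrev Site (d : ℕ) (L : EvenSize) : Type := Fin d → ZMod L.1

/-- The nearest-neighbour graph of the torus; `SimpleGraph.dist` is the graph distance. -/
def torusGraph (d : ℕ) (L : EvenSize) : SimpleGraph (Site d L) :=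
  SimpleGraph.fromRel fun x y => ∃ i : Fin d, y = x + Pi.single i 1

open Classical in
/-- The fattening `X^r` of a region: all sites at graph distance at most `r` from `X`. -/
def fatten {d : ℕ} {L : EvenSize} (X : Finset (Site d L)) (r : ℝ) : Finset (Site d L) :=
  Finset.univ.filter fun x => ∃ y ∈ X, ((torusGraph d L).dist x y : ℝ) ≤ r

section Regions

variable (d : ℕ) [NeZero d] (L : EvenSize)

/-- The first coordinate, with `ℤ/Lℤ` identified with `{-L/2+1, …, L/2}`. -/
def coord {d : ℕ} [NeZero d] {L : EvenSize} (x : Site d L) : ℤ := (x 0).valMinAbs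

open Classical in
/-- The half torus `Γ = {0 ≤ x₁ < L/2}`. -/
def halfTorus : Finset (Site d L) :=
  Finset.univ.filter fun x => 0 ≤ coord x ∧ (coord x : ℝ) < (L.1 : ℝ) / 2

open Classical in
/-- The boundary `{x₁ = 0}`. -/
def bdryMinus : Finset (Site d L) := Finset.univ.filter fun x => coord x = 0

open Classical in
/-- The boundary `{x₁ = L/2 - 1}`. -/
def bdryPlus : Finset (Site d L) :=
  Finset.univ.filter fun x => (coord x : ℝ) = (L.1 : ℝ) / 2 - 1

open Classical in
/-- The strip `{-L/8 ≤ x₁ ≤ L/8}`. -/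
def stripMinus : Finset (Site d L) :=
  Finset.univ.filter fun x =>
    -((L.1 : ℝ) / 8) ≤ (coord x : ℝ) ∧ (coord x : ℝ) ≤ (L.1 : ℝ) / 8

open Classical in
/-- The strip `{-L/8 ≤ x₁ - L/2 ≤ L/8}`, where the difference `x₁ - L/2` is taken in `ℤ/Lℤ` and
then represented in `{-L/2+1, …, L/2}`. -/
def stripPlus : Finset (Site d L) :=
  Finset.univ.filter fun x =>
    -((L.1 : ℝ) / 8) ≤ ((x 0 - ((L.1 / 2 : ℕ) : ZMod L.1)).valMinAbs : ℝ) ∧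
      ((x 0 - ((L.1 / 2 : ℕ) : ZMod L.1)).valMinAbs : ℝ) ≤ (L.1 : ℝ) / 8

/-- The distance of two regions in the `x₁`-direction (on the circle `ℤ/Lℤ`). If a region
is empty the value is `0`; it is only used multiplied by the numbers of sites of the regions. -/
def dist₁ {d : ℕ} [NeZero d] {L : EvenSize} (X Y : Finset (Site d L)) : ℕ :=
  sInf {r : ℕ | ∃ x ∈ X, ∃ y ∈ Y, r = (x 0 - y 0).valMinAbs.natAbs}

end Regions

/-! ### Spin systems and lattice fermions -/

/-- The two kinds of systems. -/
inductive SystemKind : Type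
  | spin
  | fermion

/-- Labels of the standard orthonormal basis of the total Hilbert space. For spins, the product
basis of `⨂ₓ ℂⁿ`. For fermions, the occupation-number basis of the antisymmetric Fock space over
`ℓ²(Λ, ℂⁿ)`: finite sets of occupied modes `(x, σ)`. -/
@[reducible] def Config : SystemKind → (d n : ℕ) → EvenSize → Type
  | .spin, d, n, L => Site d L → Fin n
  | .fermion, d, n, L => Finset (Site d L × Fin n)

instance instFintypeConfig : (K : SystemKind) → (d n : ℕ) → (L : EvenSize) →
    Fintype (Config K d n L)
  | .spin, d, n, L => inferInstanceAs (Fintype (Site d L → Fin n))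
  | .fermion, d, n, L => inferInstanceAs (Fintype (Finset (Site d L × Fin n)))

instance instDecidableEqConfig : (K : SystemKind) → (d n : ℕ) → (L : EvenSize) →
    DecidableEq (Config K d n L)
  | .spin, d, n, L => inferInstanceAs (DecidableEq (Site d L → Fin n))
  | .fermion, d, n, L => inferInstanceAs (DecidableEq (Finset (Site d L × Fin n)))

/-- All linear operators on the Hilbert space with orthonormal basis labelled by `ι`, with the
operator norm and the adjoint. -/
abbrev OpOn (ι : Type) [Fintype ι] : Type := EuclideanSpace ℂ ι →L[ℂ] EuclideanSpace ℂ ι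

/-- The operator with prescribed matrix elements in the standard basis. -/
def ofMatrix {ι : Type} [Fintype ι] [DecidableEq ι] (M : Matrix ι ι ℂ) : OpOn ι :=
  Matrix.toEuclideanCLM (n := ι) (𝕜 := ℂ) M

/-- The total Hilbert space. -/
abbrev Hilb (K : SystemKind) (d n : ℕ) (L : EvenSize) : Type :=
  EuclideanSpace ℂ (Config K d n L)

/-- All linear operators on the total Hilbert space. -/
abbrev Op (K : SystemKind) (d n : ℕ) (L : EvenSize) : Type := OpOn (Config K d n L)

open Classical in
/-- The matrix of `O ⊗ 1`, where `O` acts on `⨂_{x ∈ X} ℂⁿ` and `1` on the other sites. -/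
def extendMatrix {d n : ℕ} {L : EvenSize} (X : Finset (Site d L))
    (O : Matrix (X → Fin n) (X → Fin n) ℂ) :
    Matrix (Site d L → Fin n) (Site d L → Fin n) ℂ :=
  Matrix.of fun s t =>
    if ∀ x, x ∉ X → s x = t x then O (fun x => s x) (fun x => t x) else 0

/-- The spin observables supported in `X`: operators of the form `O ⊗ 1`. -/
def spinLocal {d n : ℕ} {L : EvenSize} (X : Finset (Site d L)) : Set (OpOn (Site d L → Fin n)) :=
  {A | ∃ O : Matrix (X → Fin n) (X → Fin n) ℂ, A = ofMatrix (extendMatrix X O)}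

/-- A fixed enumeration of the fermionic modes; it only enters the sign convention. -/
def modeRank {d n : ℕ} {L : EvenSize} (m : Site d L × Fin n) : ℕ :=
  (Fintype.equivFin (Site d L × Fin n) m : ℕ)

/-- The annihilation operator `c_m` of the mode `m = (x, σ)` on Fock space:
`c_m e_t = (-1)^{#{m' ∈ t : m' before m}} e_{t \ {m}}` if `m ∈ t`, and `c_m e_t = 0` otherwise. -/
def annih {d n : ℕ} {L : EvenSize} (m : Site d L × Fin n) : OpOn (Finset (Site d L × Fin n)) :=
  ofMatrix (Matrix.of fun s t : Finset (Site d L × Fin n) =>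
    if m ∈ t ∧ s = t.erase m then
      (-1 : ℂ) ^ (t.filter fun m' => modeRank m' < modeRank m).card
    else 0)

/-- The creation and annihilation operators of the modes located in `X`. -/
def ladder {d n : ℕ} {L : EvenSize} (X : Finset (Site d L)) : Set (OpOn (Finset (Site d L × Fin n))) :=
  {a | ∃ m : Site d L × Fin n, m.1 ∈ X ∧ (a = annih m ∨ a = star (annih m))}

/-- The even fermionic observables supported in `X`: the algebra generated by the monomials of
even degree in the creation and annihilation operators located in `X`. -/
def fermionLocal {d n : ℕ} {L : EvenSize} (X : Finset (Site d L)) : Set (OpOn (Finset (Site d L × Fin n))) :=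
  {A | A ∈ Algebra.adjoin ℂ {B : OpOn (Finset (Site d L × Fin n)) |
    ∃ l : List (OpOn (Finset (Site d L × Fin n))), (∀ a ∈ l, a ∈ ladder X) ∧ Even l.length ∧ B = l.prod}}

/-- The algebra `𝒜_X` of observables supported in the region `X`. -/
def localAlg : (K : SystemKind) → {d n : ℕ} → {L : EvenSize} → Finset (Site d L) →
    Set (Op K d n L)
  | .spin, _, _, _, X => spinLocal X
  | .fermion, _, _, _, X => fermionLocal X

/-! ### Asymptotics, states and the assumptions -/

/-- `f = O(L^{-∞})`. -/
def IsOInfty (f : EvenSize → ℝ) : Prop :=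
  ∀ k : ℕ, ∃ C : ℝ, ∀ L : EvenSize, |f L| ≤ C / (L.1 : ℝ) ^ k

/-- `f = O(|Λ_L|)` with `|Λ_L| = L^d`. -/
def IsOVolume (d : ℕ) (f : EvenSize → ℝ) : Prop :=
  ∃ C : ℝ, ∀ L : EvenSize, |f L| ≤ C * (Fintype.card (Site d L) : ℝ)

section Assumptions

variable {K : SystemKind} {d n : ℕ} [NeZero d]

/-- The expectation `⟨ψ, A ψ⟩`. -/
def expect {L : EvenSize} (ψ : Hilb K d n L) (A : Op K d n L) : ℂ := inner ℂ ψ (A ψ)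

/-- The variance `‖(A - ⟨ψ, A ψ⟩) ψ‖²`. -/
def variance {L : EvenSize} (ψ : Hilb K d n L) (A : Op K d n L) : ℝ :=
  ‖A ψ - expect ψ A • ψ‖ ^ 2

/-- Local charges: self-adjoint, supported at one site, with integer spectrum. -/
structure IsLocalCharge (q : (L : EvenSize) → Site d L → Op K d n L) : Prop where
  mem : ∀ L x, q L x ∈ localAlg K {x}
  selfAdjoint : ∀ L x, IsSelfAdjoint (q L x)
  integral : ∀ L x, spectrum ℂ (q L x) ⊆ Set.range ((↑) : ℤ → ℂ)

/-- The charge `Q = Q_Γ` of the half torus. -/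
def halfCharge (q : (L : EvenSize) → Site d L → Op K d n L) (L : EvenSize) : Op K d n L :=
  ∑ x ∈ halfTorus d L, q L x

/-- `U` is an almost local unitary of the observable algebra: `U* A U` is approximated in `𝒜_{X^r}`
up to `‖A‖ |X| O(r^{-∞})`, uniformly in `A ∈ 𝒜_X`, `X` and `L`. -/
structure IsAlmostLocalUnitary (U : (L : EvenSize) → Op K d n L) : Prop where
  mem : ∀ L, U L ∈ localAlg K (Finset.univ : Finset (Site d L))
  unitary : ∀ L, U L ∈ unitary (Op K d n L)
  almostLocal : ∃ C : ℕ → ℝ, ∀ (L : EvenSize) (X : Finset (Site d L)) (A : Op K d n L),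
    A ∈ localAlg K X → ∀ r : ℕ, ∃ R : Op K d n L, R ∈ localAlg K (fatten X (r : ℝ)) ∧
      ∀ k : ℕ, (r : ℝ) ^ k * ‖star (U L) * A * U L - R‖ ≤ C k * (‖A‖ * (X.card : ℝ))

/-- `T₋`, `T₊` are observables in the strips witnessing local charge conservation by `U`. -/
structure IsTransportedCharge (Q U Tm Tp : (L : EvenSize) → Op K d n L) : Prop where
  mem_minus : ∀ L, Tm L ∈ localAlg K (stripMinus d L)
  mem_plus : ∀ L, Tp L ∈ localAlg K (stripPlus d L)
  selfAdjoint_minus : ∀ L, IsSelfAdjoint (Tm L)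
  selfAdjoint_plus : ∀ L, IsSelfAdjoint (Tp L)
  approx : IsOInfty fun L => ‖(star (U L) * Q L * U L - Q L) - Tm L - Tp L‖

/-- The state has local charge fluctuations. -/
def HasLocalChargeFluctuations (Q : (L : EvenSize) → Op K d n L)
    (Ω : (L : EvenSize) → Hilb K d n L) : Prop :=
  ∃ Km Kp : (L : EvenSize) → Op K d n L,
    (∀ L, Km L ∈ localAlg K (fatten (bdryMinus d L) ((L.1 : ℝ) / 16))) ∧
    (∀ L, Kp L ∈ localAlg K (fatten (bdryPlus d L) ((L.1 : ℝ) / 16))) ∧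
    (∀ L, IsSelfAdjoint (Km L)) ∧ (∀ L, IsSelfAdjoint (Kp L)) ∧
    (IsOVolume d fun L => ‖Km L‖) ∧ (IsOVolume d fun L => ‖Kp L‖) ∧
    IsOInfty fun L => variance (Ω L) (Q L - Km L - Kp L)

/-- The state is (exponentially) clustering in the `x₁`-direction. -/
def IsClustering (Ω : (L : EvenSize) → Hilb K d n L) : Prop :=
  ∃ c C : ℝ, 0 < c ∧ 0 < C ∧ ∀ (L : EvenSize) (X Y : Finset (Site d L)) (A B : Op K d n L),
    A ∈ localAlg K X → B ∈ localAlg K Y →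
      ‖expect (Ω L) (A * B) - expect (Ω L) A * expect (Ω L) B‖ ≤
        C * ‖A‖ * ‖B‖ * (X.card : ℝ) * (Y.card : ℝ) * Real.exp (-c * (dist₁ X Y : ℝ))

end Assumptions

end

end ManyBodyIndex

open ManyBodyIndex

/-! Put `Qbar` = Q − K₋ − K₊, so that Ω is nearly an eigenvector of `Qbar`. Since U fixes Ω up to a
phase and a small error, Ω is nearly an eigenvector of U*`Qbar`U with the same eigenvalue. Charge
conservation and almost locality give U*`Qbar`U ≈ `QbarU`, where `QbarU` differs from `Qbar` only
near the two boundaries. Hence e^{is`QbarU`} e^{−is`Qbar`} nearly fixes Ω, and it factorizes into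
commuting unitaries Z₋(s) Z₊(s), one at each boundary (`Zm_mul_Zp`). By clustering, Ω is then nearly
an eigenvector of Z₋(s) alone, and z(s) = ⟨Z₋(s)⟩ has modulus close to one (`norm_star_Zm_sub_le`).

The number z(2π) is now computed twice. Differentiation gives z′ ≈ iτz with τ = ⟨T₋ − J₋ + K₋⟩ and
J₋ ≈ U*K₋U, so z(2π) ≈ e^{2πiτ} (`norm_z_sub_exp_le`); invariance of Ω gives ⟨J₋⟩ ≈ ⟨K₋⟩, that is, τ
≈ ⟨T₋⟩ (`norm_expect_Gm_sub_expect_Tm_le`). On the other hand, let Q₋ be the part of Q in the left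
strip and V = e^{2πi(Q₋−K₋)}. Integrality of the charges and e^{2πi(Q+T₋)} ≈ 1 show Z₋(2π) ≈ U*VUV*.
Since Ω is nearly a common eigenvector of U and V, this commutator acts trivially and z(2π) ≈ 1
(`norm_z_two_pi_sub_one_le`). Therefore e^{2πi⟨T₋⟩} ≈ 1.

The analysis is done on one torus with a single error ε and yields the bound 600·M·√ε, where M
bounds norms of order |Λ|. Being O(L^{-∞}) survives both the square root and the factor |Λ|. The
rest supplies the input: observables in disjoint strips commute, and small fattenings of the
boundaries stay inside the strips. -/

namespace ManyBodyIndex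

/-! ### Unitary groups of bounded self-adjoint operators. -/

section Flow

variable {H : Type*} [NormedAddCommGroup H] [InnerProductSpace ℂ H] [CompleteSpace H]

/-- The one-parameter group `exp (i s A)`. -/
noncomputable def flow (A : H →L[ℂ] H) (s : ℝ) : H →L[ℂ] H :=
  NormedSpace.exp (((s : ℂ) * Complex.I) • A)

lemma flow_zero (A : H →L[ℂ] H) : flow A 0 = 1 := by
  simp [flow, NormedSpace.exp_zero]

lemma flow_add_of_commute {A B : H →L[ℂ] H} (h : Commute A B) (s : ℝ) :
    flow (A + B) s = flow A s * flow B s := by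
  let +nondep : NormedAlgebra ℚ (H →L[ℂ] H) := .restrictScalars ℚ ℂ _
  rw [flow, smul_add, NormedSpace.exp_add_of_commute ((h.smul_left _).smul_right _)]
  rfl

lemma flow_neg_mul_self (A : H →L[ℂ] H) (s : ℝ) : flow (-A) s * flow A s = 1 := by
  rw [← flow_add_of_commute (Commute.refl A).neg_left, neg_add_cancel]
  simp [flow, NormedSpace.exp_zero]

lemma flow_mul_neg_self (A : H →L[ℂ] H) (s : ℝ) : flow A s * flow (-A) s = 1 := by
  simpa using flow_neg_mul_self (-A) s

lemma commute_flow_left {A B : H →L[ℂ] H} (h : Commute A B) (s : ℝ) : Commute (flow A s) B :=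
  Commute.exp_left (h.smul_left _)

lemma commute_flow {A B : H →L[ℂ] H} (h : Commute A B) (s t : ℝ) :
    Commute (flow A s) (flow B t) :=
  Commute.exp ((h.smul_left _).smul_right _)

lemma star_flow {A : H →L[ℂ] H} (hA : IsSelfAdjoint A) (s : ℝ) :
    star (flow A s) = flow (-A) s := by
  rw [flow, NormedSpace.star_exp, star_smul, hA.star_eq, flow]
  simp

lemma flow_mem_unitary {A : H →L[ℂ] H} (hA : IsSelfAdjoint A) (s : ℝ) :
    flow A s ∈ unitary (H →L[ℂ] H) := by
  rw [Unitary.mem_iff, star_flow hA]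
  exact ⟨flow_neg_mul_self A s, flow_mul_neg_self A s⟩

lemma norm_apply_of_mem_unitary {V : H →L[ℂ] H} (hV : V ∈ unitary (H →L[ℂ] H)) (x : H) :
    ‖V x‖ = ‖x‖ := by
  have h : V.adjoint.comp V = 1 := (Unitary.mem_iff.1 hV).1
  exact ContinuousLinearMap.norm_map_iff_adjoint_comp_self V |>.2 h x

lemma norm_le_one_of_mem_unitary {V : H →L[ℂ] H} (hV : V ∈ unitary (H →L[ℂ] H)) : ‖V‖ ≤ 1 :=
  V.opNorm_le_bound zero_le_one fun x => by rw [norm_apply_of_mem_unitary hV, one_mul]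

lemma norm_flow_apply {A : H →L[ℂ] H} (hA : IsSelfAdjoint A) (s : ℝ) (x : H) :
    ‖flow A s x‖ = ‖x‖ :=
  norm_apply_of_mem_unitary (flow_mem_unitary hA s) x

lemma norm_flow_le {A : H →L[ℂ] H} (hA : IsSelfAdjoint A) (s : ℝ) : ‖flow A s‖ ≤ 1 :=
  norm_le_one_of_mem_unitary (flow_mem_unitary hA s)

lemma flow_conj {V : H →L[ℂ] H} (hV : V ∈ unitary (H →L[ℂ] H)) (A : H →L[ℂ] H) (s : ℝ) :
    flow (star V * A * V) s = star V * flow A s * V := by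
  let +nondep : NormedAlgebra ℚ (H →L[ℂ] H) := .restrictScalars ℚ ℂ _
  have h1 : SemiconjBy V (((s : ℂ) * Complex.I) • (star V * A * V))
      (((s : ℂ) * Complex.I) • A) := by
    simp only [SemiconjBy, mul_smul_comm, smul_mul_assoc]
    rw [← mul_assoc, ← mul_assoc, (Unitary.mem_iff.1 hV).2, one_mul]
  have h2 : V * flow (star V * A * V) s = flow A s * V := h1.exp_right
  rw [mul_assoc (star V) (flow A s), ← h2, ← mul_assoc, (Unitary.mem_iff.1 hV).1, one_mul]

lemma hasDerivAt_flow (A : H →L[ℂ] H) (s : ℝ) :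
    HasDerivAt (flow A) (Complex.I • (flow A s * A)) s := by
  have h := hasDerivAt_exp_smul_const (𝕂 := ℝ) (Complex.I • A) s
  have e : (fun u : ℝ => NormedSpace.exp (u • (Complex.I • A))) = flow A := by
    funext u
    rw [flow, mul_smul]; rfl
  rw [e] at h
  have e2 : NormedSpace.exp (s • Complex.I • A) = flow A s := congrFun e s
  rwa [e2, mul_smul_comm] at h

/-- The exponential is a limit of polynomials in `A`, hence the closedness assumption. -/
lemma flow_mem (𝒜 : Subalgebra ℂ (H →L[ℂ] H)) (h𝒜 : IsClosed (𝒜 : Set (H →L[ℂ] H)))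
    {A : H →L[ℂ] H} (hA : A ∈ 𝒜) (s : ℝ) : flow A s ∈ 𝒜 := by
  rw [flow, NormedSpace.exp_eq_tsum ℂ]
  exact tsum_mem h𝒜 fun i => 𝒜.smul_mem (𝒜.pow_mem (𝒜.smul_mem hA _) _) _

lemma hasDerivAt_flow_apply (A : H →L[ℂ] H) (x : H) (s : ℝ) :
    HasDerivAt (fun t => flow A t x) (Complex.I • flow A s (A x)) s := by
  have h := ((ContinuousLinearMap.apply ℂ H x).restrictScalars ℝ).hasFDerivAt.comp_hasDerivAt s
    (hasDerivAt_flow A s)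
  simpa [Function.comp_def] using h

lemma norm_flow_apply_sub_self_le {A : H →L[ℂ] H} (hA : IsSelfAdjoint A) (x : H) {s : ℝ}
    (hs : 0 ≤ s) : ‖flow A s x - x‖ ≤ s * ‖A x‖ := by
  have h := norm_image_sub_le_of_norm_deriv_le_segment' (f := fun t => flow A t x)
    (f' := fun t => Complex.I • flow A t (A x)) (C := ‖A x‖) (a := 0) (b := s)
    (fun t _ => (hasDerivAt_flow_apply A x t).hasDerivWithinAt)
    (fun t _ => by rw [norm_smul, norm_flow_apply hA]; simp) s (Set.right_mem_Icc.2 hs)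
  simpa [flow_zero, mul_comm] using h

lemma flow_smul_one (r s : ℝ) :
    flow ((r : ℂ) • (1 : H →L[ℂ] H)) s = Complex.exp (s * r * Complex.I) • 1 := by
  rw [flow, smul_smul, ← Algebra.algebraMap_eq_smul_one, ← NormedSpace.algebraMap_exp_comm,
    Algebra.algebraMap_eq_smul_one, ← Complex.exp_eq_exp_ℂ]
  congr 2; ring

/-- Approximate eigenvectors evolve by a phase, with an error linear in time: subtracting the scalar
r from A splits off the phase and reduces to r = 0. -/
lemma norm_flow_apply_sub_smul_le {A : H →L[ℂ] H} (hA : IsSelfAdjoint A) (r : ℝ) (x : H) {s : ℝ}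
    (hs : 0 ≤ s) :
    ‖flow A s x - Complex.exp (s * r * Complex.I) • x‖ ≤ s * ‖A x - (r : ℂ) • x‖ := by
  set B : H →L[ℂ] H := A - (r : ℂ) • 1 with hB
  have hBs : IsSelfAdjoint B := by
    refine hA.sub ?_
    rw [isSelfAdjoint_iff, star_smul, star_one]; simp
  have hc : Commute ((r : ℂ) • (1 : H →L[ℂ] H)) B := (Commute.one_left B).smul_left _
  have e : flow A s = Complex.exp (s * r * Complex.I) • flow B s := by
    have : A = (r : ℂ) • 1 + B := by rw [hB]; abel
    rw [this, flow_add_of_commute hc, flow_smul_one, smul_mul_assoc, one_mul]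
  rw [e, smul_apply, ← smul_sub, norm_smul]
  have e1 : ‖Complex.exp (s * r * Complex.I)‖ = 1 := by
    rw [← Complex.ofReal_mul]; exact Complex.norm_exp_ofReal_mul_I _
  rw [e1, one_mul]
  simpa [hB] using norm_flow_apply_sub_self_le hBs x hs

lemma hasDerivAt_flow_mul_flow_neg (A B : H →L[ℂ] H) (s : ℝ) :
    HasDerivAt (fun t => flow A t * flow (-B) t)
      (Complex.I • (flow A s * (A - B) * flow (-B) s)) s := by
  have h := (hasDerivAt_flow A s).mul (hasDerivAt_flow (-B) s)
  refine h.congr_deriv ?_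
  have hc : flow (-B) s * -B = -B * flow (-B) s :=
    (commute_flow_left (Commute.refl (-B)) s).eq
  rw [hc, smul_mul_assoc, mul_smul_comm, ← smul_add]
  congr 1
  noncomm_ring

/-- Duhamel: the derivative of e^{itA} e^{−itB} is i e^{itA}(A − B)e^{−itB}, of norm at most ‖A −
B‖. -/
lemma norm_flow_sub_flow_le {A B : H →L[ℂ] H} (hA : IsSelfAdjoint A) (hB : IsSelfAdjoint B)
    {s : ℝ} (hs : 0 ≤ s) : ‖flow A s - flow B s‖ ≤ s * ‖A - B‖ := by
  have h := norm_image_sub_le_of_norm_deriv_le_segment' (f := fun t => flow A t * flow (-B) t)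
    (C := ‖A - B‖) (a := 0) (b := s)
    (fun t _ => (hasDerivAt_flow_mul_flow_neg A B t).hasDerivWithinAt)
    (fun t _ => by
      rw [norm_smul, Complex.norm_I, one_mul]
      calc _ ≤ ‖flow A t‖ * ‖A - B‖ * ‖flow (-B) t‖ := norm_mul₃_le
        _ ≤ 1 * ‖A - B‖ * 1 := by
          gcongr
          exacts [norm_flow_le hA t, norm_flow_le hB.neg t]
        _ = _ := by ring) s (Set.right_mem_Icc.2 hs)
  simp only [flow_zero, mul_one, sub_zero] at h
  have e : flow A s - flow B s = (flow A s * flow (-B) s - 1) * flow B s := by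
    rw [sub_mul, mul_assoc, flow_neg_mul_self, mul_one, one_mul]
  rw [e]
  calc _ ≤ ‖flow A s * flow (-B) s - 1‖ * ‖flow B s‖ := norm_mul_le _ _
    _ ≤ (‖A - B‖ * s) * 1 := by
      gcongr
      exact norm_flow_le hB s
    _ = _ := by ring

end Flow

/-! ### Contractions whose expectation has modulus close to one. -/

section Clustering

variable {H : Type*} [NormedAddCommGroup H] [InnerProductSpace ℂ H]

local notation "⟪" x ", " y "⟫" => inner ℂ x y

lemma norm_apply_sub_expect_sq (A : H →L[ℂ] H) {ψ : H} (hψ : ‖ψ‖ = 1) :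
    ‖A ψ - ⟪ψ, A ψ⟫ • ψ‖ ^ 2 = ‖A ψ‖ ^ 2 - ‖⟪ψ, A ψ⟫‖ ^ 2 := by
  set z := ⟪ψ, A ψ⟫ with hz
  have h := norm_sub_sq (𝕜 := ℂ) (A ψ) (z • ψ)
  rw [h, inner_smul_right, norm_smul, hψ, mul_one]
  have h2 : ⟪A ψ, ψ⟫ = (starRingEnd ℂ) z := (inner_conj_symm _ _).symm
  rw [h2, Complex.mul_conj, Complex.normSq_eq_norm_sq]
  simp only [RCLike.re_to_complex, Complex.ofReal_re]
  ring

lemma norm_expect_le {A : H →L[ℂ] H} {ψ : H} (hψ : ‖ψ‖ = 1) : ‖⟪ψ, A ψ⟫‖ ≤ ‖A‖ := by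
  calc _ ≤ ‖ψ‖ * ‖A ψ‖ := norm_inner_le_norm _ _
    _ ≤ 1 * (‖A‖ * 1) := by
      rw [hψ]; gcongr; simpa [hψ] using A.le_opNorm ψ
    _ = _ := by ring

/-- Near-equality in Cauchy–Schwarz: the variance is at most 1 − |⟨A⟩|² ≤ 2η. Passing from the
variance to the norm costs a square root, the source of √ε in the final bound. -/
lemma norm_apply_sub_expect_le {A : H →L[ℂ] H} {ψ : H} (hψ : ‖ψ‖ = 1) (hA : ‖A‖ ≤ 1) {η : ℝ}
    (h : 1 - η ≤ ‖⟪ψ, A ψ⟫‖) : ‖A ψ - ⟪ψ, A ψ⟫ • ψ‖ ≤ √(2 * η) := by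
  apply Real.le_sqrt_of_sq_le
  rw [norm_apply_sub_expect_sq A hψ]
  have h1 : ‖A ψ‖ ≤ 1 := by
    calc _ ≤ ‖A‖ * ‖ψ‖ := A.le_opNorm ψ
      _ ≤ 1 := by rw [hψ, mul_one]; exact hA
  have h2 := (norm_expect_le (A := A) hψ).trans hA
  nlinarith [norm_nonneg (A ψ), norm_nonneg ⟪ψ, A ψ⟫]

lemma norm_star_apply_sub_conj_expect_le [CompleteSpace H] {A : H →L[ℂ] H} {ψ : H} (hψ : ‖ψ‖ = 1) (hA : ‖A‖ ≤ 1)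
    {η : ℝ} (h : 1 - η ≤ ‖⟪ψ, A ψ⟫‖) :
    ‖star A ψ - (starRingEnd ℂ) ⟪ψ, A ψ⟫ • ψ‖ ≤ √(2 * η) := by
  have e : (starRingEnd ℂ) ⟪ψ, A ψ⟫ = ⟪ψ, star A ψ⟫ := by
    rw [inner_conj_symm, ContinuousLinearMap.star_eq_adjoint,
      ContinuousLinearMap.adjoint_inner_right]
  rw [e]
  refine norm_apply_sub_expect_le hψ (by rwa [norm_star]) ?_
  rw [← e, RCLike.norm_conj]
  exact h

/-- If a product of two uncorrelated contractions fixes a state up to a phase, then each factor has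
expectation of modulus close to one. -/
lemma one_sub_le_norm_expect_of_clustering {A B : H →L[ℂ] H} {ψ : H} (hψ : ‖ψ‖ = 1)
    (hB : ‖B‖ ≤ 1) {γ δ : ℝ} {w : ℂ} (hw : ‖w‖ = 1)
    (hc : ‖⟪ψ, (A * B) ψ⟫ - ⟪ψ, A ψ⟫ * ⟪ψ, B ψ⟫‖ ≤ γ)
    (h : ‖(A * B) ψ - w • ψ‖ ≤ δ) : 1 - (δ + γ) ≤ ‖⟪ψ, A ψ⟫‖ := by
  have h1 : ‖⟪ψ, (A * B) ψ⟫ - w‖ ≤ δ := by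
    have e : ⟪ψ, (A * B) ψ⟫ - w = ⟪ψ, (A * B) ψ - w • ψ⟫ := by
      rw [inner_sub_right, inner_smul_right, inner_self_eq_norm_sq_to_K, hψ]; simp
    rw [e]
    refine (norm_inner_le_norm _ _).trans ?_
    rwa [hψ, one_mul]
  have h2 : ‖⟪ψ, A ψ⟫ * ⟪ψ, B ψ⟫‖ ≤ ‖⟪ψ, A ψ⟫‖ := by
    rw [norm_mul]
    exact mul_le_of_le_one_right (norm_nonneg _) ((norm_expect_le hψ).trans hB)
  have h3 : ‖w - ⟪ψ, A ψ⟫ * ⟪ψ, B ψ⟫‖ ≤ δ + γ := by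
    refine (norm_sub_le_norm_sub_add_norm_sub w ⟪ψ, (A * B) ψ⟫ _).trans (add_le_add ?_ hc)
    rwa [norm_sub_rev]
  have h4 := norm_sub_norm_le w (⟪ψ, A ψ⟫ * ⟪ψ, B ψ⟫)
  linarith

end Clustering

end ManyBodyIndex

/-! ### Quantization on a single torus. -/

namespace ManyBodyIndex

/-- The data entering the quantization of the transported charge on a single torus: two commuting
algebras `𝒜`, `ℬ` of observables near the two boundaries, the charge `Q0 + Qm + Qp` of the half
torus, the transported charges `Tm`, `Tp`, the charge fluctuations `Km`, `Kp` and local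
approximations `Jm`, `Jp` of their images under conjugation with `U`. All errors are at most `ε`. -/
structure TransportData (H : Type*) [NormedAddCommGroup H] [InnerProductSpace ℂ H]
    [CompleteSpace H] where
  (𝒜 ℬ : Subalgebra ℂ (H →L[ℂ] H))
  isClosed_𝒜 : IsClosed (𝒜 : Set (H →L[ℂ] H))
  isClosed_ℬ : IsClosed (ℬ : Set (H →L[ℂ] H))
  commute : ∀ a ∈ 𝒜, ∀ b ∈ ℬ, Commute a b
  (Q0 Qm Qp Tm Tp Km Kp Jm Jp U : H →L[ℂ] H)
  Q0_commute_𝒜 : ∀ a ∈ 𝒜, Commute Q0 a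
  Q0_commute_ℬ : ∀ b ∈ ℬ, Commute Q0 b
  Qm_mem : Qm ∈ 𝒜
  Tm_mem : Tm ∈ 𝒜
  Km_mem : Km ∈ 𝒜
  Jm_mem : Jm ∈ 𝒜
  Qp_mem : Qp ∈ ℬ
  Tp_mem : Tp ∈ ℬ
  Kp_mem : Kp ∈ ℬ
  Jp_mem : Jp ∈ ℬ
  Q0_sa : IsSelfAdjoint Q0
  Qm_sa : IsSelfAdjoint Qm
  Tm_sa : IsSelfAdjoint Tm
  Km_sa : IsSelfAdjoint Km
  Jm_sa : IsSelfAdjoint Jm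
  Qp_sa : IsSelfAdjoint Qp
  Tp_sa : IsSelfAdjoint Tp
  Kp_sa : IsSelfAdjoint Kp
  Jp_sa : IsSelfAdjoint Jp
  Q0_period : flow Q0 (2 * Real.pi) = 1
  Qm_period : flow Qm (2 * Real.pi) = 1
  Qp_period : flow Qp (2 * Real.pi) = 1
  U_unitary : U ∈ unitary (H →L[ℂ] H)
  Ω : H
  norm_Ω : ‖Ω‖ = 1
  (ε M lam : ℝ)
  u : ℂ
  norm_u : ‖u‖ ≤ 1
  ε_nonneg : 0 ≤ ε
  ε_le : ε ≤ 1
  one_le_M : 1 ≤ M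
  norm_Tm : ‖Tm‖ ≤ M
  norm_Km : ‖Km‖ ≤ M
  norm_Jm : ‖Jm‖ ≤ M
  transport : ‖star U * (Q0 + Qm + Qp) * U - (Q0 + Qm + Qp) - Tm - Tp‖ ≤ ε
  approx_Km : ‖star U * Km * U - Jm‖ ≤ ε
  approx_Kp : ‖star U * Kp * U - Jp‖ ≤ ε
  invariant : ‖U Ω - u • Ω‖ ≤ ε
  fluctuation : ‖(Q0 + Qm + Qp - Km - Kp) Ω - (lam : ℂ) • Ω‖ ≤ ε
  clustering : ∀ a ∈ 𝒜, ∀ b ∈ ℬ,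
    ‖inner ℂ Ω ((a * b) Ω) - inner ℂ Ω (a Ω) * inner ℂ Ω (b Ω)‖ ≤ ε * ‖a‖ * ‖b‖
  period : ‖flow (Q0 + Qm + Qp + Tm) (2 * Real.pi) - 1‖ ≤ ε

namespace TransportData

variable {H : Type*} [NormedAddCommGroup H] [InnerProductSpace ℂ H] [CompleteSpace H]
  (d : TransportData H)

local notation "⟪" x ", " y "⟫" => inner ℂ x y

lemma flow_split {a b : H →L[ℂ] H} (ha : a ∈ d.𝒜) (hb : b ∈ d.ℬ) (s : ℝ) :
    flow (d.Q0 + a + b) s = flow d.Q0 s * flow a s * flow b s := by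
  rw [flow_add_of_commute ((d.Q0_commute_ℬ b hb).add_left (d.commute a ha b hb)),
    flow_add_of_commute (d.Q0_commute_𝒜 a ha)]

lemma flow_split_period {a b : H →L[ℂ] H} (ha : a ∈ d.𝒜) (hb : b ∈ d.ℬ) :
    flow (d.Q0 + a + b) (2 * Real.pi) = flow a (2 * Real.pi) * flow b (2 * Real.pi) := by
  rw [d.flow_split ha hb, d.Q0_period, one_mul]

/-- The charge with the fluctuations at the boundaries removed. -/
def Qbar : H →L[ℂ] H := d.Q0 + d.Qm + d.Qp - d.Km - d.Kp

lemma Qbar_sa : IsSelfAdjoint d.Qbar :=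
  ((((d.Q0_sa.add d.Qm_sa).add d.Qp_sa).sub d.Km_sa).sub d.Kp_sa)

/-- The approximate image of `Qbar` under conjugation with `U`. -/
def QbarU : H →L[ℂ] H := d.Q0 + (d.Qm + (d.Tm - d.Jm)) + (d.Qp + (d.Tp - d.Jp))

lemma QbarU_sa : IsSelfAdjoint d.QbarU :=
  (d.Q0_sa.add (d.Qm_sa.add (d.Tm_sa.sub d.Jm_sa))).add (d.Qp_sa.add (d.Tp_sa.sub d.Jp_sa))

lemma Dm_mem : d.Qm + (d.Tm - d.Jm) ∈ d.𝒜 :=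
  d.𝒜.add_mem d.Qm_mem (d.𝒜.sub_mem d.Tm_mem d.Jm_mem)

lemma Dp_mem : d.Qp + (d.Tp - d.Jp) ∈ d.ℬ :=
  d.ℬ.add_mem d.Qp_mem (d.ℬ.sub_mem d.Tp_mem d.Jp_mem)

lemma QKm_mem : d.Qm - d.Km ∈ d.𝒜 := d.𝒜.sub_mem d.Qm_mem d.Km_mem

lemma QKp_mem : d.Qp - d.Kp ∈ d.ℬ := d.ℬ.sub_mem d.Qp_mem d.Kp_mem

lemma Dm_sa : IsSelfAdjoint (d.Qm + (d.Tm - d.Jm)) := d.Qm_sa.add (d.Tm_sa.sub d.Jm_sa)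

lemma Dp_sa : IsSelfAdjoint (d.Qp + (d.Tp - d.Jp)) := d.Qp_sa.add (d.Tp_sa.sub d.Jp_sa)

lemma QKm_sa : IsSelfAdjoint (d.Qm - d.Km) := d.Qm_sa.sub d.Km_sa

lemma QKp_sa : IsSelfAdjoint (d.Qp - d.Kp) := d.Qp_sa.sub d.Kp_sa

/-- The local factor at the left boundary. -/
noncomputable def Zm (s : ℝ) : H →L[ℂ] H :=
  flow (d.Qm + (d.Tm - d.Jm)) s * flow (-(d.Qm - d.Km)) s

/-- The local factor at the right boundary. -/
noncomputable def Zp (s : ℝ) : H →L[ℂ] H :=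
  flow (d.Qp + (d.Tp - d.Jp)) s * flow (-(d.Qp - d.Kp)) s

lemma Zm_mem (s : ℝ) : d.Zm s ∈ d.𝒜 :=
  d.𝒜.mul_mem (flow_mem _ d.isClosed_𝒜 d.Dm_mem s)
    (flow_mem _ d.isClosed_𝒜 (d.𝒜.neg_mem d.QKm_mem) s)

lemma Zp_mem (s : ℝ) : d.Zp s ∈ d.ℬ :=
  d.ℬ.mul_mem (flow_mem _ d.isClosed_ℬ d.Dp_mem s)
    (flow_mem _ d.isClosed_ℬ (d.ℬ.neg_mem d.QKp_mem) s)

lemma norm_Zm_le (s : ℝ) : ‖d.Zm s‖ ≤ 1 :=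
  norm_le_one_of_mem_unitary
    (mul_mem (flow_mem_unitary d.Dm_sa s) (flow_mem_unitary d.QKm_sa.neg s))

lemma norm_Zp_le (s : ℝ) : ‖d.Zp s‖ ≤ 1 :=
  norm_le_one_of_mem_unitary
    (mul_mem (flow_mem_unitary d.Dp_sa s) (flow_mem_unitary d.QKp_sa.neg s))

lemma flow_neg_Qbar (s : ℝ) :
    flow (-d.Qbar) s = flow (-d.Q0) s * flow (-(d.Qm - d.Km)) s * flow (-(d.Qp - d.Kp)) s := by
  have e : -d.Qbar = -d.Q0 + -(d.Qm - d.Km) + -(d.Qp - d.Kp) := by rw [Qbar]; abel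
  rw [e, flow_add_of_commute, flow_add_of_commute]
  · exact (d.Q0_commute_𝒜 _ (d.𝒜.neg_mem d.QKm_mem)).neg_left
  · exact (d.Q0_commute_ℬ _ (d.ℬ.neg_mem d.QKp_mem)).neg_left.add_left
      (d.commute _ (d.𝒜.neg_mem d.QKm_mem) _ (d.ℬ.neg_mem d.QKp_mem))

/-- The bulk charge `Q0` is common to both generators and commutes with everything near the
boundaries, so its two flows cancel; the left and right factors then commute past each other. -/
lemma Zm_mul_Zp (s : ℝ) : flow d.QbarU s * flow (-d.Qbar) s = d.Zm s * d.Zp s := by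
  rw [d.flow_neg_Qbar, QbarU, d.flow_split d.Dm_mem d.Dp_mem, Zm, Zp]
  have h1 := (commute_flow (d.commute _ (d.𝒜.neg_mem d.QKm_mem) _ d.Dp_mem) s s).eq
  have h2 := (commute_flow ((d.Q0_commute_𝒜 _ d.Dm_mem).neg_left) s s).eq
  have h3 := (commute_flow ((d.Q0_commute_ℬ _ d.Dp_mem).neg_left) s s).eq
  have h0 := flow_mul_neg_self d.Q0 s
  generalize flow (d.Qm + (d.Tm - d.Jm)) s = A1 at *
  generalize flow (d.Qp + (d.Tp - d.Jp)) s = B1 at *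
  generalize flow (-(d.Qm - d.Km)) s = A2 at *
  generalize flow (-(d.Qp - d.Kp)) s = B2 at *
  calc flow d.Q0 s * A1 * B1 * (flow (-d.Q0) s * A2 * B2)
      = flow d.Q0 s * A1 * (B1 * flow (-d.Q0) s) * A2 * B2 := by simp only [mul_assoc]
    _ = flow d.Q0 s * (A1 * flow (-d.Q0) s) * (B1 * A2) * B2 := by
        rw [← h3]; simp only [mul_assoc]
    _ = (flow d.Q0 s * flow (-d.Q0) s) * A1 * A2 * B1 * B2 := by
        rw [← h2, ← h1]; simp only [mul_assoc]
    _ = A1 * A2 * (B1 * B2) := by rw [h0, one_mul]; simp only [mul_assoc]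

lemma norm_conj_Qbar_sub_le : ‖star d.U * d.Qbar * d.U - d.QbarU‖ ≤ 3 * d.ε := by
  have e : star d.U * d.Qbar * d.U - d.QbarU
      = (star d.U * (d.Q0 + d.Qm + d.Qp) * d.U - (d.Q0 + d.Qm + d.Qp) - d.Tm - d.Tp)
        - (star d.U * d.Km * d.U - d.Jm) - (star d.U * d.Kp * d.U - d.Jp) := by
    rw [Qbar, QbarU]; noncomm_ring
  rw [e]
  refine (norm_sub_le _ _).trans ?_
  have := norm_sub_le (star d.U * (d.Q0 + d.Qm + d.Qp) * d.U - (d.Q0 + d.Qm + d.Qp) - d.Tm - d.Tp)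
    (star d.U * d.Km * d.U - d.Jm)
  linarith [d.transport, d.approx_Km, d.approx_Kp]

lemma conj_sa {A : H →L[ℂ] H} (hA : IsSelfAdjoint A) : IsSelfAdjoint (star d.U * A * d.U) :=
  hA.conjugate' d.U

/-- The eigenphase of `flow Qbar s`. -/
noncomputable def phase (s : ℝ) : ℂ := Complex.exp (s * d.lam * Complex.I)

lemma norm_phase (s : ℝ) : ‖d.phase s‖ = 1 := by
  rw [phase, ← Complex.ofReal_mul]; exact Complex.norm_exp_ofReal_mul_I _

lemma norm_flow_Qbar_sub_le {s : ℝ} (hs : 0 ≤ s) :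
    ‖flow d.Qbar s d.Ω - d.phase s • d.Ω‖ ≤ s * d.ε :=
  (norm_flow_apply_sub_smul_le d.Qbar_sa d.lam d.Ω hs).trans
    (mul_le_mul_of_nonneg_left d.fluctuation hs)

lemma norm_flow_neg_Qbar_sub_le {s : ℝ} (hs : 0 ≤ s) :
    ‖flow (-d.Qbar) s d.Ω - (d.phase s)⁻¹ • d.Ω‖ ≤ s * d.ε := by
  have h := norm_flow_apply_sub_smul_le d.Qbar_sa.neg (-d.lam) d.Ω hs
  have e : Complex.exp (s * ((-d.lam : ℝ) : ℂ) * Complex.I) = (d.phase s)⁻¹ := by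
    rw [phase, ← Complex.exp_neg]; congr 1; push_cast; ring
  rw [e] at h
  refine h.trans (mul_le_mul_of_nonneg_left ?_ hs)
  have e2 : (-d.Qbar) d.Ω - ((-d.lam : ℝ) : ℂ) • d.Ω = -(d.Qbar d.Ω - (d.lam : ℂ) • d.Ω) := by
    rw [Complex.ofReal_neg, neg_smul, neg_apply]; abel
  rw [e2, norm_neg]
  exact d.fluctuation

lemma star_mem_unitary : star d.U ∈ unitary (H →L[ℂ] H) := Unitary.star_mem d.U_unitary

lemma star_U_U_apply (x : H) : star d.U (d.U x) = x := by
  rw [← mul_apply_eq_comp, (Unitary.mem_iff.1 d.U_unitary).1]; rfl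

lemma norm_smul_star_U_sub_le : ‖d.u • star d.U d.Ω - d.Ω‖ ≤ d.ε := by
  have e : d.u • star d.U d.Ω - d.Ω = -star d.U (d.U d.Ω - d.u • d.Ω) := by
    rw [map_sub, d.star_U_U_apply, map_smul]; abel
  rw [e, norm_neg, norm_apply_of_mem_unitary d.star_mem_unitary]
  exact d.invariant

/-- Apply U, then the flow, then U*: the phase of U is picked up and removed again. Each use of
invariance costs ε and the flow costs sε. -/
lemma norm_flow_conj_Qbar_sub_le {s : ℝ} (hs : 0 ≤ s) :
    ‖flow (star d.U * d.Qbar * d.U) s d.Ω - d.phase s • d.Ω‖ ≤ (2 + s) * d.ε := by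
  rw [flow_conj d.U_unitary]
  have e : (star d.U * flow d.Qbar s * d.U) d.Ω - d.phase s • d.Ω
      = star d.U (flow d.Qbar s (d.U d.Ω - d.u • d.Ω))
        + d.u • star d.U (flow d.Qbar s d.Ω - d.phase s • d.Ω)
        + d.phase s • (d.u • star d.U d.Ω - d.Ω) := by
    simp only [mul_apply_eq_comp, map_sub, map_smul, smul_sub,
      smul_comm (d.phase s) d.u]
    abel
  rw [e]
  refine (norm_add₃_le).trans ?_
  rw [norm_smul, norm_smul, d.norm_phase, one_mul,
    norm_apply_of_mem_unitary d.star_mem_unitary, norm_flow_apply d.Qbar_sa,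
    norm_apply_of_mem_unitary d.star_mem_unitary]
  have h1 := d.invariant
  have h2 := d.norm_flow_Qbar_sub_le hs
  have h3 := d.norm_smul_star_U_sub_le
  have h4 := mul_le_mul d.norm_u h2 (norm_nonneg _) zero_le_one
  linarith

lemma norm_Zm_mul_Zp_sub_le {s : ℝ} (hs : 0 ≤ s) :
    ‖(d.Zm s * d.Zp s) d.Ω - (1 : ℂ) • d.Ω‖ ≤ (2 + 5 * s) * d.ε := by
  rw [← d.Zm_mul_Zp]
  have hp : (d.phase s)⁻¹ * d.phase s = 1 :=
    inv_mul_cancel₀ (Complex.exp_ne_zero _)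
  -- The errors of the three terms are sε, 3sε and (2 + s)ε.
  have e : (flow d.QbarU s * flow (-d.Qbar) s) d.Ω - (1 : ℂ) • d.Ω
      = flow d.QbarU s (flow (-d.Qbar) s d.Ω - (d.phase s)⁻¹ • d.Ω)
        + (d.phase s)⁻¹ • ((flow d.QbarU s - flow (star d.U * d.Qbar * d.U) s) d.Ω)
        + (d.phase s)⁻¹ • (flow (star d.U * d.Qbar * d.U) s d.Ω - d.phase s • d.Ω) := by
    rw [smul_sub (d.phase s)⁻¹, smul_smul, hp, sub_apply, smul_sub, map_sub, map_smul,
      mul_apply_eq_comp]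
    abel
  rw [e]
  refine (norm_add₃_le).trans ?_
  rw [norm_smul, norm_smul, norm_inv, d.norm_phase, inv_one, one_mul, one_mul,
    norm_flow_apply d.QbarU_sa]
  have h1 := d.norm_flow_neg_Qbar_sub_le hs
  have h2 := d.norm_flow_conj_Qbar_sub_le hs
  have h3 := norm_flow_sub_flow_le d.QbarU_sa (d.conj_sa d.Qbar_sa) hs
  have h4 := (flow d.QbarU s - flow (star d.U * d.Qbar * d.U) s).le_opNorm d.Ω
  rw [d.norm_Ω, mul_one] at h4
  have h5 := d.norm_conj_Qbar_sub_le
  rw [norm_sub_rev] at h5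
  have h6 := mul_le_mul_of_nonneg_left h5 hs
  linarith

lemma clustering_of_norm_le_one {a b : H →L[ℂ] H} (ha : a ∈ d.𝒜) (hb : b ∈ d.ℬ) (ha1 : ‖a‖ ≤ 1)
    (hb1 : ‖b‖ ≤ 1) : ‖⟪d.Ω, (a * b) d.Ω⟫ - ⟪d.Ω, a d.Ω⟫ * ⟪d.Ω, b d.Ω⟫‖ ≤ d.ε := by
  refine (d.clustering a ha b hb).trans ?_
  have : ‖a‖ * ‖b‖ ≤ 1 := mul_le_one₀ ha1 (norm_nonneg _) hb1
  rw [mul_assoc]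
  exact mul_le_of_le_one_right d.ε_nonneg this

/-- The expectation of the left factor. -/
noncomputable def z (s : ℝ) : ℂ := ⟪d.Ω, d.Zm s d.Ω⟫

lemma two_pi_le : 2 * Real.pi ≤ 7 := by linarith [Real.pi_lt_d2]

lemma ε_le_sqrt : d.ε ≤ √d.ε := Real.le_sqrt_of_sq_le (by nlinarith [d.ε_nonneg, d.ε_le])

lemma sqrt_le_of_le {a c : ℝ} (hc : 0 ≤ c) (h : a ≤ c ^ 2) : √(a * d.ε) ≤ c * √d.ε := by
  calc √(a * d.ε) ≤ √(c ^ 2 * d.ε) := Real.sqrt_le_sqrt (mul_le_mul_of_nonneg_right h d.ε_nonneg)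
    _ = c * √d.ε := by rw [Real.sqrt_mul (sq_nonneg c), Real.sqrt_sq hc]

lemma norm_star_Zm_sub_le {s : ℝ} (hs : 0 ≤ s) (hs' : s ≤ 2 * Real.pi) :
    ‖star (d.Zm s) d.Ω - (starRingEnd ℂ) (d.z s) • d.Ω‖ ≤ 9 * √d.ε := by
  have h := one_sub_le_norm_expect_of_clustering d.norm_Ω (d.norm_Zp_le s) norm_one
    (d.clustering_of_norm_le_one (d.Zm_mem s) (d.Zp_mem s) (d.norm_Zm_le s) (d.norm_Zp_le s))
    (d.norm_Zm_mul_Zp_sub_le hs)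
  refine (norm_star_apply_sub_conj_expect_le d.norm_Ω (d.norm_Zm_le s) h).trans ?_
  have e : 2 * ((2 + 5 * s) * d.ε + d.ε) = (2 * (3 + 5 * s)) * d.ε := by ring
  rw [e]
  -- With s ≤ 7, 2(3 + 5s) ≤ 76 ≤ 9².
  exact d.sqrt_le_of_le (by norm_num) (by linarith [two_pi_le])

/-! ### The differential equation for the expectation of the left factor. -/

/-- The generator of the left factor. -/
def Gm : H →L[ℂ] H := d.Tm - d.Jm + d.Km

lemma norm_Gm_le : ‖d.Gm‖ ≤ 3 * d.M := by
  have h1 := norm_add_le (d.Tm - d.Jm) d.Km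
  have h2 := norm_sub_le d.Tm d.Jm
  rw [Gm]
  linarith [d.norm_Tm, d.norm_Jm, d.norm_Km]

lemma Gm_mem : d.Gm ∈ d.𝒜 := d.𝒜.add_mem (d.𝒜.sub_mem d.Tm_mem d.Jm_mem) d.Km_mem

lemma Gm_sa : IsSelfAdjoint d.Gm := (d.Tm_sa.sub d.Jm_sa).add d.Km_sa

/-- Conjugation of the generator with the global charge flow is a local operation. -/
lemma flow_mul_Gm_mul_flow (s : ℝ) :
    flow (d.Qm - d.Km) s * d.Gm * flow (-(d.Qm - d.Km)) s
      = flow d.Qbar s * d.Gm * flow (-d.Qbar) s := by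
  have e : d.Qbar = (d.Qm - d.Km) + (d.Q0 + (d.Qp - d.Kp)) := by rw [Qbar]; abel
  have hc : ∀ a ∈ d.𝒜, Commute a (d.Q0 + (d.Qp - d.Kp)) := fun a ha =>
    (d.Q0_commute_𝒜 a ha).symm.add_right (d.commute a ha _ d.QKp_mem)
  have h1 : flow d.Qbar s = flow (d.Qm - d.Km) s * flow (d.Q0 + (d.Qp - d.Kp)) s := by
    rw [e, flow_add_of_commute (hc _ d.QKm_mem)]
  have h2 : flow (-d.Qbar) s = flow (-(d.Q0 + (d.Qp - d.Kp))) s * flow (-(d.Qm - d.Km)) s := by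
    rw [e, neg_add_rev, flow_add_of_commute (hc _ d.QKm_mem).symm.neg_left.neg_right]
  have h3 := (commute_flow_left (hc _ d.Gm_mem).symm s).eq
  have h4 := flow_mul_neg_self (d.Q0 + (d.Qp - d.Kp)) s
  rw [h1, h2]
  generalize flow (d.Q0 + (d.Qp - d.Kp)) s = R at *
  generalize flow (-(d.Q0 + (d.Qp - d.Kp))) s = R' at *
  calc _ = flow (d.Qm - d.Km) s * d.Gm * (R * R') * flow (-(d.Qm - d.Km)) s := by
        rw [h4, mul_one]
    _ = flow (d.Qm - d.Km) s * (d.Gm * R) * R' * flow (-(d.Qm - d.Km)) s := by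
        simp only [mul_assoc]
    _ = _ := by rw [← h3]; simp only [mul_assoc]

/-- The derivative is written with `Zm` on the left and the generator conjugated by the global flow,
because the global flow is what is known to fix Ω up to a phase at every time s. -/
lemma hasDerivAt_Zm (s : ℝ) :
    HasDerivAt d.Zm (Complex.I • (d.Zm s * (flow d.Qbar s * d.Gm * flow (-d.Qbar) s))) s := by
  have h := hasDerivAt_flow_mul_flow_neg (d.Qm + (d.Tm - d.Jm)) (d.Qm - d.Km) s
  refine h.congr_deriv ?_
  have e : d.Qm + (d.Tm - d.Jm) - (d.Qm - d.Km) = d.Gm := by rw [Gm]; abel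
  rw [← d.flow_mul_Gm_mul_flow, e, Zm]
  have h4 := flow_neg_mul_self (d.Qm - d.Km) s
  congr 1
  calc _ = flow (d.Qm + (d.Tm - d.Jm)) s * (flow (-(d.Qm - d.Km)) s * flow (d.Qm - d.Km) s)
        * d.Gm * flow (-(d.Qm - d.Km)) s := by rw [h4, mul_one]
    _ = _ := by simp only [mul_assoc]

lemma hasDerivAt_z (s : ℝ) :
    HasDerivAt d.z
      (Complex.I * ⟪star (d.Zm s) d.Ω, (flow d.Qbar s * d.Gm * flow (-d.Qbar) s) d.Ω⟫) s := by
  have h := (((innerSL ℂ d.Ω).comp (ContinuousLinearMap.apply ℂ H d.Ω)).restrictScalars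
    ℝ).hasFDerivAt.comp_hasDerivAt s (d.hasDerivAt_Zm s)
  refine h.congr_deriv ?_
  simp only [ContinuousLinearMap.coe_restrictScalars', ContinuousLinearMap.comp_apply,
    ContinuousLinearMap.apply_apply, innerSL_apply_apply, smul_apply, inner_smul_right]
  congr 1
  rw [ContinuousLinearMap.star_eq_adjoint, ContinuousLinearMap.adjoint_inner_left]
  rfl

/-- The expectation of the generator, a real number. -/
noncomputable def τ : ℝ := (⟪d.Ω, d.Gm d.Ω⟫).re

lemma ofReal_re_expect {A : H →L[ℂ] H} (hA : IsSelfAdjoint A) (x : H) :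
    (((⟪x, A x⟫).re : ℝ) : ℂ) = ⟪x, A x⟫ := by
  apply Complex.conj_eq_iff_re.1
  rw [inner_conj_symm, ← ContinuousLinearMap.adjoint_inner_right,
    ← ContinuousLinearMap.star_eq_adjoint, hA.star_eq]

/-- Replace the evolved Ω by a phase times Ω in both slots of the quadratic form; the phases cancel
there. Each replacement costs sε times ‖`Gm`‖ ≤ 3M. -/
lemma norm_expect_conj_Gm_sub_le {s : ℝ} (hs : 0 ≤ s) :
    ‖⟪d.Ω, (flow d.Qbar s * d.Gm * flow (-d.Qbar) s) d.Ω⟫ - (d.τ : ℂ)‖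
      ≤ 6 * s * d.M * d.ε := by
  set φ := flow (-d.Qbar) s d.Ω with hφ
  set w := (d.phase s)⁻¹ • d.Ω with hw
  have hwn : ‖w‖ = 1 := by
    rw [hw, norm_smul, norm_inv, d.norm_phase, d.norm_Ω, inv_one, mul_one]
  have hφn : ‖φ‖ = 1 := by rw [hφ, norm_flow_apply d.Qbar_sa.neg, d.norm_Ω]
  have hd : ‖φ - w‖ ≤ s * d.ε := d.norm_flow_neg_Qbar_sub_le hs
  have e1 : ⟪d.Ω, (flow d.Qbar s * d.Gm * flow (-d.Qbar) s) d.Ω⟫ = ⟪φ, d.Gm φ⟫ := by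
    rw [hφ, ← star_flow d.Qbar_sa, ContinuousLinearMap.star_eq_adjoint,
      ContinuousLinearMap.adjoint_inner_left]
    rfl
  have e2 : (d.τ : ℂ) = ⟪w, d.Gm w⟫ := by
    rw [τ, ofReal_re_expect d.Gm_sa, hw, map_smul, inner_smul_left, inner_smul_right, ← mul_assoc,
      Complex.conj_mul', norm_inv, d.norm_phase]
    simp
  have e3 : ⟪φ, d.Gm φ⟫ - ⟪w, d.Gm w⟫ = ⟪φ - w, d.Gm φ⟫ + ⟪w, d.Gm (φ - w)⟫ := by
    rw [inner_sub_left, map_sub, inner_sub_right]; ring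
  rw [e1, e2, e3]
  have hG := d.norm_Gm_le
  have b1 : ‖d.Gm φ‖ ≤ 3 * d.M := by
    have := d.Gm.le_opNorm φ
    rw [hφn, mul_one] at this
    exact this.trans hG
  have hse : 0 ≤ s * d.ε := mul_nonneg hs d.ε_nonneg
  have hM : 0 ≤ 3 * d.M := by linarith [d.one_le_M]
  have b2 : ‖d.Gm (φ - w)‖ ≤ 3 * d.M * (s * d.ε) :=
    (d.Gm.le_opNorm _).trans (mul_le_mul hG hd (norm_nonneg _) hM)
  have b3 : ‖⟪φ - w, d.Gm φ⟫‖ ≤ (s * d.ε) * (3 * d.M) :=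
    (norm_inner_le_norm _ _).trans (mul_le_mul hd b1 (norm_nonneg _) hse)
  have b4 : ‖⟪w, d.Gm (φ - w)⟫‖ ≤ 3 * d.M * (s * d.ε) := by
    refine (norm_inner_le_norm _ _).trans ?_
    rw [hwn, one_mul]; exact b2
  refine (norm_add_le _ _).trans ?_
  linarith

lemma norm_z_le (s : ℝ) : ‖d.z s‖ ≤ 1 := (norm_expect_le d.norm_Ω).trans (d.norm_Zm_le s)

lemma norm_conj_Gm_apply_le (s : ℝ) :
    ‖(flow d.Qbar s * d.Gm * flow (-d.Qbar) s) d.Ω‖ ≤ 3 * d.M := by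
  have e : (flow d.Qbar s * d.Gm * flow (-d.Qbar) s) d.Ω
      = flow d.Qbar s (d.Gm (flow (-d.Qbar) s d.Ω)) := rfl
  rw [e, norm_flow_apply d.Qbar_sa]
  have h := d.Gm.le_opNorm (flow (-d.Qbar) s d.Ω)
  rw [norm_flow_apply d.Qbar_sa.neg, d.norm_Ω, mul_one] at h
  exact h.trans d.norm_Gm_le

/-- Moving `Zm` to the left slot as its adjoint, where Ω is nearly an eigenvector, pulls out z(s).
The constant is 69 = 9·3 + 6·7. -/
lemma norm_deriv_z_sub_le {s : ℝ} (hs : 0 ≤ s) (hs' : s ≤ 2 * Real.pi) :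
    ‖Complex.I * ⟪star (d.Zm s) d.Ω, (flow d.Qbar s * d.Gm * flow (-d.Qbar) s) d.Ω⟫
      - Complex.I * d.τ * d.z s‖ ≤ 69 * d.M * √d.ε := by
  set x := (flow d.Qbar s * d.Gm * flow (-d.Qbar) s) d.Ω with hx
  have e : Complex.I * ⟪star (d.Zm s) d.Ω, x⟫ - Complex.I * d.τ * d.z s
      = Complex.I * (⟪star (d.Zm s) d.Ω - (starRingEnd ℂ) (d.z s) • d.Ω, x⟫
        + d.z s * (⟪d.Ω, x⟫ - d.τ)) := by
    rw [inner_sub_left, inner_smul_left, Complex.conj_conj]; ring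
  rw [e, norm_mul, Complex.norm_I, one_mul]
  refine (norm_add_le _ _).trans ?_
  have h1 : ‖⟪star (d.Zm s) d.Ω - (starRingEnd ℂ) (d.z s) • d.Ω, x⟫‖
      ≤ 9 * √d.ε * (3 * d.M) :=
    (norm_inner_le_norm _ _).trans (mul_le_mul (d.norm_star_Zm_sub_le hs hs')
      (d.norm_conj_Gm_apply_le s) (norm_nonneg _) (by positivity))
  have h2 : ‖d.z s * (⟪d.Ω, x⟫ - d.τ)‖ ≤ 1 * (6 * s * d.M * d.ε) := by
    rw [norm_mul]
    exact mul_le_mul (d.norm_z_le s) (d.norm_expect_conj_Gm_sub_le hs) (norm_nonneg _) zero_le_one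
  have hM := d.one_le_M
  have h3 : 6 * s * d.M * d.ε ≤ 42 * d.M * √d.ε := by
    have : 6 * s ≤ 42 := by linarith [two_pi_le]
    exact mul_le_mul (mul_le_mul_of_nonneg_right this (by linarith)) d.ε_le_sqrt d.ε_nonneg
      (by linarith)
  linarith

/-- Integrating factor: e^{−iτs} z(s) starts at 1 and has derivative bounded by the defect of the
differential equation. Since 2π ≤ 7, the constant is 7·69 = 483. -/
lemma norm_z_sub_exp_le :
    ‖d.z (2 * Real.pi) - Complex.exp (2 * Real.pi * Complex.I * d.τ)‖
      ≤ 483 * d.M * √d.ε := by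
  set c : ℂ := Complex.I * d.τ with hc
  have hexp : ∀ t : ℝ, ‖Complex.exp (-(c * t))‖ = 1 := fun t => by
    have : -(c * t) = ((-(d.τ * t) : ℝ) : ℂ) * Complex.I := by rw [hc]; push_cast; ring
    rw [this]; exact Complex.norm_exp_ofReal_mul_I _
  have hder : ∀ t : ℝ, HasDerivAt (fun t : ℝ => Complex.exp (-(c * t)))
      (Complex.exp (-(c * t)) * (-c)) t := fun t => by
    have h1 : HasDerivAt (fun t : ℝ => (t : ℂ)) 1 t := Complex.ofRealCLM.hasDerivAt
    have h2 := ((h1.const_mul c).neg).cexp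
    simpa using h2
  have h := norm_image_sub_le_of_norm_deriv_le_segment'
    (f := fun t : ℝ => Complex.exp (-(c * t)) * d.z t)
    (C := 69 * d.M * √d.ε) (a := 0) (b := 2 * Real.pi)
    (fun t _ => ((hder t).mul (d.hasDerivAt_z t)).hasDerivWithinAt)
    (fun t ht => by
      refine le_trans (le_of_eq ?_) (d.norm_deriv_z_sub_le ht.1 ht.2.le)
      rw [← one_mul ‖Complex.I * ⟪star (d.Zm t) d.Ω, _⟫ - _‖, ← hexp t, ← norm_mul]
      congr 1
      rw [hc]; ring) (2 * Real.pi) (Set.right_mem_Icc.2 Real.two_pi_pos.le)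
  have h0 : d.z 0 = 1 := by
    simp [z, Zm, flow_zero, inner_self_eq_norm_sq_to_K, d.norm_Ω]
  simp only [h0, Complex.ofReal_zero, mul_zero, neg_zero, Complex.exp_zero, mul_one,
    sub_zero] at h
  have e : d.z (2 * Real.pi) - Complex.exp (2 * Real.pi * Complex.I * d.τ)
      = Complex.exp (2 * Real.pi * Complex.I * d.τ)
        * (Complex.exp (-(c * ((2 * Real.pi : ℝ) : ℂ))) * d.z (2 * Real.pi) - 1) := by
    have : -(c * ((2 * Real.pi : ℝ) : ℂ)) = -(2 * Real.pi * Complex.I * d.τ) := by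
      rw [hc]; push_cast; ring
    rw [this, mul_sub, ← mul_assoc, ← Complex.exp_add]
    simp
  have e1 : ‖Complex.exp (2 * Real.pi * Complex.I * d.τ)‖ = 1 := by
    have : (2 * Real.pi * Complex.I * d.τ : ℂ) = ((2 * Real.pi * d.τ : ℝ) : ℂ) * Complex.I := by
      push_cast; ring
    rw [this]; exact Complex.norm_exp_ofReal_mul_I _
  rw [e, norm_mul, e1, one_mul]
  refine h.trans ?_
  have : 0 ≤ d.M * √d.ε := mul_nonneg (by linarith [d.one_le_M]) (Real.sqrt_nonneg _)
  nlinarith [two_pi_le]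

/-! ### Evaluation over a full period. -/

/-- The flow of the left boundary charge over a full period. -/
noncomputable def V : H →L[ℂ] H := flow (d.Qm - d.Km) (2 * Real.pi)

lemma V_mem_unitary : d.V ∈ unitary (H →L[ℂ] H) := flow_mem_unitary d.QKm_sa _

/-- At time 2π the integer bulk charge drops out, so the flow of `Qbar` is a product of a left and a
right unitary, and clustering applies to it. -/
lemma one_sub_le_norm_expect_V : 1 - 8 * d.ε ≤ ‖⟪d.Ω, d.V d.Ω⟫‖ := by
  have hp := Real.two_pi_pos.le
  have hV : ‖d.V‖ ≤ 1 := norm_le_one_of_mem_unitary d.V_mem_unitary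
  have hW : ‖flow (d.Qp - d.Kp) (2 * Real.pi)‖ ≤ 1 := norm_flow_le d.QKp_sa _
  have e : d.V * flow (d.Qp - d.Kp) (2 * Real.pi) = flow d.Qbar (2 * Real.pi) := by
    have : d.Qbar = d.Q0 + (d.Qm - d.Km) + (d.Qp - d.Kp) := by rw [Qbar]; abel
    rw [this, d.flow_split_period d.QKm_mem d.QKp_mem, V]
  have h := one_sub_le_norm_expect_of_clustering d.norm_Ω hW (d.norm_phase (2 * Real.pi))
    (d.clustering_of_norm_le_one (flow_mem _ d.isClosed_𝒜 d.QKm_mem _)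
      (flow_mem _ d.isClosed_ℬ d.QKp_mem _) hV hW)
    (δ := 2 * Real.pi * d.ε) (by
      rw [← V, e]; exact d.norm_flow_Qbar_sub_le hp)
  refine le_trans ?_ h
  nlinarith [two_pi_le, d.ε_nonneg]

/-- Conjugating e^{2πiQ} = 1 by U shows that the full-period flows of Q₋ + T₋ and Q₊ + T₊ have
product close to 1. The normalization of T₋ makes the left factor close to 1, hence also the right
one. -/
lemma norm_flow_Qp_add_Tp_sub_one_le :
    ‖flow (d.Qp + d.Tp) (2 * Real.pi) - 1‖ ≤ 8 * d.ε := by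
  have hp := Real.two_pi_pos.le
  set p := 2 * Real.pi with hpdef
  have hTm := d.𝒜.add_mem d.Qm_mem d.Tm_mem
  have hTp := d.ℬ.add_mem d.Qp_mem d.Tp_mem
  set W := flow (d.Qm + d.Tm) p
  set G := flow (d.Qp + d.Tp) p with hG
  have h1 : ‖W - 1‖ ≤ d.ε := by
    have h := d.period
    have e : d.Q0 + d.Qm + d.Qp + d.Tm = d.Q0 + (d.Qm + d.Tm) + d.Qp := by abel
    rwa [e, d.flow_split_period hTm d.Qp_mem, d.Qp_period, mul_one] at h
  have h2 : ‖1 - W * G‖ ≤ p * d.ε := by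
    have h := norm_flow_sub_flow_le (d.conj_sa ((d.Q0_sa.add d.Qm_sa).add d.Qp_sa))
      ((d.Q0_sa.add (d.Qm_sa.add d.Tm_sa)).add (d.Qp_sa.add d.Tp_sa)) hp
    rw [flow_conj d.U_unitary, d.flow_split_period d.Qm_mem d.Qp_mem, d.Qm_period, d.Qp_period,
      mul_one, mul_one, (Unitary.mem_iff.1 d.U_unitary).1, d.flow_split_period hTm hTp] at h
    refine h.trans (mul_le_mul_of_nonneg_left ?_ hp)
    refine le_trans (le_of_eq ?_) d.transport
    congr 1; abel
  have h3 : ‖G‖ ≤ 1 := norm_flow_le (d.Qp_sa.add d.Tp_sa) _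
  have e : G - 1 = -((W - 1) * G) - (1 - W * G) := by noncomm_ring
  rw [e]
  refine (norm_sub_le _ _).trans ?_
  rw [norm_neg]
  have h4 : ‖(W - 1) * G‖ ≤ d.ε * 1 :=
    (norm_mul_le _ _).trans (mul_le_mul h1 h3 (norm_nonneg _) d.ε_nonneg)
  nlinarith [two_pi_le, d.ε_nonneg]

/-- Only the left fluctuation is subtracted here: U*(Q − K₋)U ≈ Q + T₋ + T₊ − J₋. Over a full period
the conjugated side is U*VU, and on the other side the right factor is the flow of Q₊ + T₊, which is
close to 1. -/
lemma norm_flow_Dm_sub_conj_V_le :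
    ‖flow (d.Qm + (d.Tm - d.Jm)) (2 * Real.pi) - star d.U * d.V * d.U‖ ≤ 22 * d.ε := by
  have hp := Real.two_pi_pos.le
  have hTp := d.ℬ.add_mem d.Qp_mem d.Tp_mem
  have h1 : ‖star d.U * d.V * d.U - flow (d.Qm + (d.Tm - d.Jm)) (2 * Real.pi)
      * flow (d.Qp + d.Tp) (2 * Real.pi)‖ ≤ 2 * Real.pi * (2 * d.ε) := by
    have h := norm_flow_sub_flow_le (d.conj_sa ((d.Q0_sa.add d.QKm_sa).add d.Qp_sa))
      ((d.Q0_sa.add d.Dm_sa).add (d.Qp_sa.add d.Tp_sa)) hp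
    rw [flow_conj d.U_unitary, d.flow_split_period d.QKm_mem d.Qp_mem, d.Qp_period,
      mul_one, d.flow_split_period d.Dm_mem hTp, ← V] at h
    refine h.trans (mul_le_mul_of_nonneg_left ?_ hp)
    have e : star d.U * (d.Q0 + (d.Qm - d.Km) + d.Qp) * d.U
        - (d.Q0 + (d.Qm + (d.Tm - d.Jm)) + (d.Qp + d.Tp))
      = (star d.U * (d.Q0 + d.Qm + d.Qp) * d.U - (d.Q0 + d.Qm + d.Qp) - d.Tm - d.Tp)
        - (star d.U * d.Km * d.U - d.Jm) := by noncomm_ring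
    rw [e]
    refine (norm_sub_le _ _).trans ?_
    linarith [d.transport, d.approx_Km]
  have h2 := d.norm_flow_Qp_add_Tp_sub_one_le
  have h3 : ‖flow (d.Qm + (d.Tm - d.Jm)) (2 * Real.pi)‖ ≤ 1 := norm_flow_le d.Dm_sa _
  set F := flow (d.Qm + (d.Tm - d.Jm)) (2 * Real.pi)
  set G := flow (d.Qp + d.Tp) (2 * Real.pi)
  have e : F - star d.U * d.V * d.U = -(F * (G - 1)) - (star d.U * d.V * d.U - F * G) := by
    noncomm_ring
  rw [e]
  refine (norm_sub_le _ _).trans ?_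
  rw [norm_neg]
  have h4 : ‖F * (G - 1)‖ ≤ 1 * (8 * d.ε) :=
    (norm_mul_le _ _).trans (mul_le_mul h3 h2 (norm_nonneg _) zero_le_one)
  nlinarith [two_pi_le, d.ε_nonneg]

/-- Ω is nearly an eigenvector of V, V*, U and U*, and the four phases cancel. The errors add up to
4 + 1 + 4 + 1 + 16 = 26, the last term coming from |v|² being only close to 1. -/
lemma norm_commutator_apply_sub_le :
    ‖(star d.U * d.V * d.U * star d.V) d.Ω - d.Ω‖ ≤ 26 * √d.ε := by
  set v := ⟪d.Ω, d.V d.Ω⟫ with hv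
  have hV : ‖d.V‖ ≤ 1 := norm_le_one_of_mem_unitary d.V_mem_unitary
  have hv1 : ‖v‖ ≤ 1 := (norm_expect_le d.norm_Ω).trans hV
  have hv2 := d.one_sub_le_norm_expect_V
  rw [← hv] at hv2
  have hσ : √(2 * (8 * d.ε)) ≤ 4 * √d.ε := by
    rw [← mul_assoc]; exact d.sqrt_le_of_le (by norm_num) (by norm_num)
  have h1 := (norm_star_apply_sub_conj_expect_le d.norm_Ω hV hv2).trans hσ
  have h2 := (norm_apply_sub_expect_le d.norm_Ω hV hv2).trans hσ
  rw [← hv] at h1 h2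
  have e : (star d.U * d.V * d.U * star d.V) d.Ω - d.Ω
      = (star d.U * d.V * d.U) (star d.V d.Ω - (starRingEnd ℂ) v • d.Ω)
        + (starRingEnd ℂ) v • (star d.U * d.V) (d.U d.Ω - d.u • d.Ω)
        + ((starRingEnd ℂ) v * d.u) • star d.U (d.V d.Ω - v • d.Ω)
        + ((starRingEnd ℂ) v * v) • (d.u • star d.U d.Ω - d.Ω)
        + ((starRingEnd ℂ) v * v - 1) • d.Ω := by
    simp only [mul_apply_eq_comp, map_sub, map_smul, smul_sub, sub_smul, smul_smul,
      one_smul]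
    have : (starRingEnd ℂ) v * d.u * v = (starRingEnd ℂ) v * v * d.u := by ring
    rw [this]
    abel
  have hUVU : star d.U * d.V * d.U ∈ unitary (H →L[ℂ] H) :=
    mul_mem (mul_mem d.star_mem_unitary d.V_mem_unitary) d.U_unitary
  have hUV : star d.U * d.V ∈ unitary (H →L[ℂ] H) := mul_mem d.star_mem_unitary d.V_mem_unitary
  have n1 : ‖(star d.U * d.V * d.U) (star d.V d.Ω - (starRingEnd ℂ) v • d.Ω)‖ ≤ 4 * √d.ε := by
    rwa [norm_apply_of_mem_unitary hUVU]
  have n2 : ‖(starRingEnd ℂ) v • (star d.U * d.V) (d.U d.Ω - d.u • d.Ω)‖ ≤ 1 * d.ε := by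
    rw [norm_smul, norm_apply_of_mem_unitary hUV, RCLike.norm_conj]
    exact mul_le_mul hv1 d.invariant (norm_nonneg _) zero_le_one
  have n3 : ‖((starRingEnd ℂ) v * d.u) • star d.U (d.V d.Ω - v • d.Ω)‖
      ≤ (1 * 1) * (4 * √d.ε) := by
    rw [norm_smul, norm_apply_of_mem_unitary d.star_mem_unitary, norm_mul, RCLike.norm_conj]
    exact mul_le_mul (mul_le_mul hv1 d.norm_u (norm_nonneg _) zero_le_one) h2 (norm_nonneg _)
      (by norm_num)
  have n4 : ‖((starRingEnd ℂ) v * v) • (d.u • star d.U d.Ω - d.Ω)‖ ≤ (1 * 1) * d.ε := by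
    rw [norm_smul, norm_mul, RCLike.norm_conj]
    exact mul_le_mul (mul_le_mul hv1 hv1 (norm_nonneg _) zero_le_one) d.norm_smul_star_U_sub_le
      (norm_nonneg _) (by norm_num)
  have n5 : ‖((starRingEnd ℂ) v * v - 1) • d.Ω‖ ≤ 16 * d.ε := by
    rw [norm_smul, d.norm_Ω, mul_one, Complex.conj_mul']
    have : ((‖v‖ : ℂ) ^ 2 - 1) = ((‖v‖ ^ 2 - 1 : ℝ) : ℂ) := by push_cast; ring
    rw [this, Complex.norm_real, Real.norm_eq_abs, abs_le]
    constructor <;> nlinarith [norm_nonneg v, d.ε_nonneg]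
  rw [e]
  have t1 := norm_add_le ((star d.U * d.V * d.U) (star d.V d.Ω - (starRingEnd ℂ) v • d.Ω)
        + (starRingEnd ℂ) v • (star d.U * d.V) (d.U d.Ω - d.u • d.Ω)
        + ((starRingEnd ℂ) v * d.u) • star d.U (d.V d.Ω - v • d.Ω)
        + ((starRingEnd ℂ) v * v) • (d.u • star d.U d.Ω - d.Ω))
        (((starRingEnd ℂ) v * v - 1) • d.Ω)
  refine t1.trans ?_
  refine (add_le_add_left (norm_add₄_le) _).trans ?_
  linarith [d.ε_le_sqrt]

lemma norm_z_two_pi_sub_one_le : ‖d.z (2 * Real.pi) - 1‖ ≤ 48 * √d.ε := by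
  have hs : flow (-(d.Qm - d.Km)) (2 * Real.pi) = star d.V := by
    rw [V, star_flow d.QKm_sa]
  have e : d.z (2 * Real.pi) - 1
      = ⟪d.Ω, ((flow (d.Qm + (d.Tm - d.Jm)) (2 * Real.pi) - star d.U * d.V * d.U) * star d.V) d.Ω⟫
        + ⟪d.Ω, (star d.U * d.V * d.U * star d.V) d.Ω - d.Ω⟫ := by
    rw [z, Zm, hs, sub_mul, inner_sub_right, inner_self_eq_norm_sq_to_K, d.norm_Ω, sub_apply,
      inner_sub_right]
    push_cast
    ring
  rw [e]
  refine (norm_add_le _ _).trans ?_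
  have h1 : ‖(flow (d.Qm + (d.Tm - d.Jm)) (2 * Real.pi) - star d.U * d.V * d.U) * star d.V‖
      ≤ 22 * d.ε * 1 :=
    (norm_mul_le _ _).trans (mul_le_mul d.norm_flow_Dm_sub_conj_V_le
      (norm_le_one_of_mem_unitary (Unitary.star_mem d.V_mem_unitary)) (norm_nonneg _)
      (by linarith [d.ε_nonneg]))
  have h2 := (norm_expect_le d.norm_Ω).trans h1
  have h3 := (norm_inner_le_norm (𝕜 := ℂ) d.Ω
    ((star d.U * d.V * d.U * star d.V) d.Ω - d.Ω)).trans
    (mul_le_mul_of_nonneg_left d.norm_commutator_apply_sub_le (norm_nonneg _))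
  rw [d.norm_Ω, one_mul] at h3
  linarith [d.ε_le_sqrt]

/-- The two boundary terms compensate: ⟨J₋⟩ ≈ ⟨U*K₋U⟩ ≈ |u|²⟨K₋⟩ ≈ ⟨K₋⟩. -/
lemma norm_expect_Gm_sub_expect_Tm_le :
    ‖⟪d.Ω, d.Gm d.Ω⟫ - ⟪d.Ω, d.Tm d.Ω⟫‖ ≤ 5 * d.M * d.ε := by
  have hM := d.one_le_M
  have hε := d.ε_nonneg
  have e : ⟪d.Ω, d.Gm d.Ω⟫ - ⟪d.Ω, d.Tm d.Ω⟫
      = ⟪d.Ω, (star d.U * d.Km * d.U - d.Jm) d.Ω⟫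
        - (⟪d.U d.Ω - d.u • d.Ω, d.Km (d.U d.Ω)⟫
          + (starRingEnd ℂ) d.u * ⟪d.Ω, d.Km (d.U d.Ω - d.u • d.Ω)⟫)
        + (1 - (starRingEnd ℂ) d.u * d.u) * ⟪d.Ω, d.Km d.Ω⟫ := by
    have e1 : ⟪d.Ω, (star d.U * d.Km * d.U) d.Ω⟫ = ⟪d.U d.Ω, d.Km (d.U d.Ω)⟫ := by
      rw [← ContinuousLinearMap.adjoint_inner_right, ← ContinuousLinearMap.star_eq_adjoint]
      rfl
    rw [sub_apply, inner_sub_right, e1]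
    simp only [Gm, add_apply, sub_apply, map_sub, map_smul,
      inner_sub_right, inner_sub_left, inner_add_right, inner_smul_left, inner_smul_right]
    ring
  have hK : ‖⟪d.Ω, d.Km d.Ω⟫‖ ≤ d.M := (norm_expect_le d.norm_Ω).trans d.norm_Km
  have hUΩ : ‖d.U d.Ω‖ = 1 := by rw [norm_apply_of_mem_unitary d.U_unitary, d.norm_Ω]
  have b1 : ‖⟪d.Ω, (star d.U * d.Km * d.U - d.Jm) d.Ω⟫‖ ≤ d.ε :=
    (norm_expect_le d.norm_Ω).trans d.approx_Km
  have b2 : ‖⟪d.U d.Ω - d.u • d.Ω, d.Km (d.U d.Ω)⟫‖ ≤ d.ε * (d.M * 1) := by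
    refine (norm_inner_le_norm _ _).trans (mul_le_mul d.invariant ?_ (norm_nonneg _) hε)
    refine (d.Km.le_opNorm _).trans ?_
    rw [hUΩ]; gcongr; exact d.norm_Km
  have b3 : ‖(starRingEnd ℂ) d.u * ⟪d.Ω, d.Km (d.U d.Ω - d.u • d.Ω)⟫‖ ≤ 1 * (d.M * d.ε) := by
    rw [norm_mul, RCLike.norm_conj]
    refine mul_le_mul d.norm_u ?_ (norm_nonneg _) zero_le_one
    refine (norm_inner_le_norm _ _).trans ?_
    rw [d.norm_Ω, one_mul]
    exact (d.Km.le_opNorm _).trans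
      (mul_le_mul d.norm_Km d.invariant (norm_nonneg _) (by linarith))
  -- The number u is not assumed to be a phase; unitarity of U and approximate invariance force its
  -- modulus close to 1.
  have hu : 1 - d.ε ≤ ‖d.u‖ := by
    have h := norm_sub_norm_le (d.U d.Ω) (d.u • d.Ω)
    rw [hUΩ, norm_smul, d.norm_Ω, mul_one] at h
    linarith [d.invariant]
  have b4 : ‖(1 - (starRingEnd ℂ) d.u * d.u) * ⟪d.Ω, d.Km d.Ω⟫‖ ≤ 2 * d.ε * d.M := by
    rw [norm_mul]
    refine mul_le_mul ?_ hK (norm_nonneg _) (by linarith)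
    rw [Complex.conj_mul']
    have : (1 - (‖d.u‖ : ℂ) ^ 2) = ((1 - ‖d.u‖ ^ 2 : ℝ) : ℂ) := by push_cast; ring
    rw [this, Complex.norm_real, Real.norm_eq_abs, abs_le]
    constructor <;> nlinarith [norm_nonneg d.u, d.norm_u]
  rw [e]
  refine (norm_add_le _ _).trans ?_
  have t := norm_sub_le ⟪d.Ω, (star d.U * d.Km * d.U - d.Jm) d.Ω⟫
    (⟪d.U d.Ω - d.u • d.Ω, d.Km (d.U d.Ω)⟫
          + (starRingEnd ℂ) d.u * ⟪d.Ω, d.Km (d.U d.Ω - d.u • d.Ω)⟫)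
  have t2 := norm_add_le ⟪d.U d.Ω - d.u • d.Ω, d.Km (d.U d.Ω)⟫
    ((starRingEnd ℂ) d.u * ⟪d.Ω, d.Km (d.U d.Ω - d.u • d.Ω)⟫)
  nlinarith

/-- Quantization of the transported charge, with an explicit error. -/
theorem norm_exp_expect_Tm_sub_one_le :
    ‖Complex.exp (2 * Real.pi * Complex.I * ((⟪d.Ω, d.Tm d.Ω⟫).re : ℝ)) - 1‖
      ≤ 600 * d.M * √d.ε := by
  set t : ℝ := (⟪d.Ω, d.Tm d.Ω⟫).re with ht
  have hM := d.one_le_M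
  have h1 := d.norm_z_sub_exp_le
  have h2 := d.norm_z_two_pi_sub_one_le
  have h3 : |d.τ - t| ≤ 5 * d.M * d.ε := by
    have h := d.norm_expect_Gm_sub_expect_Tm_le
    rw [← ofReal_re_expect d.Gm_sa, ← ofReal_re_expect d.Tm_sa, ← Complex.ofReal_sub,
      Complex.norm_real] at h
    exact h
  have h4 : ‖Complex.exp (2 * Real.pi * Complex.I * (d.τ : ℝ))
      - Complex.exp (2 * Real.pi * Complex.I * (t : ℝ))‖ ≤ 35 * d.M * √d.ε := by
    have e : Complex.exp (2 * Real.pi * Complex.I * (d.τ : ℝ))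
        - Complex.exp (2 * Real.pi * Complex.I * (t : ℝ))
        = Complex.exp (((2 * Real.pi * t : ℝ) : ℂ) * Complex.I)
          * (Complex.exp (Complex.I * ((2 * Real.pi * (d.τ - t) : ℝ) : ℂ)) - 1) := by
      rw [mul_sub, ← Complex.exp_add, mul_one]
      congr 1 <;> congr 1 <;> push_cast <;> ring
    rw [e, norm_mul, Complex.norm_exp_ofReal_mul_I, one_mul]
    refine (Real.norm_exp_I_mul_ofReal_sub_one_le).trans ?_
    rw [Real.norm_eq_abs, abs_mul, abs_of_pos Real.two_pi_pos]
    have : 2 * Real.pi * |d.τ - t| ≤ 7 * (5 * d.M * √d.ε) :=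
      mul_le_mul two_pi_le (h3.trans (mul_le_mul_of_nonneg_left d.ε_le_sqrt (by linarith)))
        (abs_nonneg _) (by norm_num)
    linarith
  have e : Complex.exp (2 * Real.pi * Complex.I * (t : ℝ)) - 1
      = -(Complex.exp (2 * Real.pi * Complex.I * (d.τ : ℝ))
          - Complex.exp (2 * Real.pi * Complex.I * (t : ℝ)))
        - (d.z (2 * Real.pi) - Complex.exp (2 * Real.pi * Complex.I * (d.τ : ℝ)))
        + (d.z (2 * Real.pi) - 1) := by ring
  rw [e]
  refine (norm_add_le _ _).trans ?_
  have t1 := norm_sub_le (-(Complex.exp (2 * Real.pi * Complex.I * (d.τ : ℝ))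
          - Complex.exp (2 * Real.pi * Complex.I * (t : ℝ))))
        (d.z (2 * Real.pi) - Complex.exp (2 * Real.pi * Complex.I * (d.τ : ℝ)))
  rw [norm_neg] at t1
  -- The three contributions sum to 35 + 483 + 48 ≤ 600.
  have : 48 * √d.ε ≤ 48 * d.M * √d.ε := by
    nlinarith [Real.sqrt_nonneg d.ε]
  nlinarith [Real.sqrt_nonneg d.ε]

end TransportData

end ManyBodyIndex

/-! ### Local algebras of spins and of fermions. -/

namespace ManyBodyIndex

section MatrixElements

variable {ι : Type} [Fintype ι] [DecidableEq ι]

lemma ofMatrix_mul (M N : Matrix ι ι ℂ) : ofMatrix (M * N) = ofMatrix M * ofMatrix N :=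
  map_mul _ _ _

lemma ofMatrix_star (M : Matrix ι ι ℂ) : ofMatrix (star M) = star (ofMatrix M) :=
  map_star _ _

lemma ofMatrix_apply (M : Matrix ι ι ℂ) (ψ : EuclideanSpace ℂ ι) (s : ι) :
    ofMatrix M ψ s = ∑ t, M s t * ψ t := rfl

end MatrixElements

section Spin

variable {d n : ℕ} {L : EvenSize} {X Y : Finset (Site d L)}

open Classical in
lemma extendMatrix_apply (O : Matrix (X → Fin n) (X → Fin n) ℂ) (s t : Site d L → Fin n) :
    extendMatrix X O s t
      = if ∀ x, x ∉ X → s x = t x then O (fun x => s x) (fun x => t x) else 0 := rfl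

lemma extendMatrix_add (O P : Matrix (X → Fin n) (X → Fin n) ℂ) :
    extendMatrix X (O + P) = extendMatrix X O + extendMatrix X P := by
  ext s t
  simp only [extendMatrix_apply, Matrix.add_apply]
  split_ifs <;> simp

lemma extendMatrix_smul (c : ℂ) (O : Matrix (X → Fin n) (X → Fin n) ℂ) :
    extendMatrix X (c • O) = c • extendMatrix X O := by
  ext s t
  simp only [extendMatrix_apply, Matrix.smul_apply]
  split_ifs <;> simp

lemma extendMatrix_star (O : Matrix (X → Fin n) (X → Fin n) ℂ) :
    extendMatrix X (star O) = star (extendMatrix X O) := by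
  ext s t
  simp only [extendMatrix_apply, Matrix.star_apply, eq_comm (a := t _)]
  split_ifs <;> simp

open Classical in
lemma extendMatrix_one : extendMatrix X (1 : Matrix (X → Fin n) (X → Fin n) ℂ) = 1 := by
  ext s t
  simp only [extendMatrix_apply, Matrix.one_apply]
  by_cases h : s = t
  · simp [h]
  · rw [if_neg h]
    split_ifs with h1 h2
    · refine absurd (funext fun x => ?_) h
      by_cases hx : x ∈ X
      · exact congrFun h2 ⟨x, hx⟩
      · exact h1 x hx
    · rfl
    · rfl

open Classical in
/-- Overwrite the configuration `s` by `u` on `X`. -/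
noncomputable def overwrite (X : Finset (Site d L)) (s : Site d L → Fin n) (u : X → Fin n) :
    Site d L → Fin n :=
  fun x => if h : x ∈ X then u ⟨x, h⟩ else s x

lemma overwrite_mem (s : Site d L → Fin n) (u : X → Fin n) :
    (fun x : X => overwrite X s u x) = u := by
  funext x; simp [overwrite]

lemma overwrite_of_notMem (s : Site d L → Fin n) (u : X → Fin n) {x : Site d L} (hx : x ∉ X) :
    overwrite X s u x = s x := by simp [overwrite, hx]

lemma overwrite_self_iff (s t : Site d L → Fin n) :
    overwrite X s (fun x : X => t x) = t ↔ ∀ x, x ∉ X → s x = t x := by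
  constructor
  · intro h x hx
    rw [← overwrite_of_notMem s (fun x : X => t x) hx, h]
  · intro h
    funext x
    by_cases hx : x ∈ X
    · simp [overwrite, hx]
    · rw [overwrite_of_notMem _ _ hx, h x hx]

open Classical in
-- Row s of O ⊗ 1 lives on the configurations that agree with s off X, and these are exactly the
-- overwrites of s on X.
lemma extendMatrix_sum_eq (O : Matrix (X → Fin n) (X → Fin n) ℂ) (s : Site d L → Fin n)
    (f : (Site d L → Fin n) → ℂ) :
    ∑ t, extendMatrix X O s t * f t
      = ∑ u : X → Fin n, O (fun x => s x) u * f (overwrite X s u) := by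
  simp only [extendMatrix_apply, ite_mul, zero_mul]
  rw [← Finset.sum_filter]
  symm
  refine Finset.sum_bij' (fun u _ => overwrite X s u) (fun t _ => fun x : X => t x) ?_ ?_ ?_ ?_ ?_
  · intro u _
    rw [Finset.mem_filter]
    exact ⟨Finset.mem_univ _, fun x hx => (overwrite_of_notMem s u hx).symm⟩
  · intro t _; exact Finset.mem_univ _
  · intro u _; exact overwrite_mem s u
  · intro t ht
    exact (overwrite_self_iff s t).2 (Finset.mem_filter.1 ht).2
  · intro u _
    rw [overwrite_mem]

open Classical in
lemma extendMatrix_mul (O P : Matrix (X → Fin n) (X → Fin n) ℂ) :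
    extendMatrix X (O * P) = extendMatrix X O * extendMatrix X P := by
  ext s t
  rw [Matrix.mul_apply, extendMatrix_sum_eq O s (fun u => extendMatrix X P u t)]
  simp only [extendMatrix_apply, overwrite_mem]
  rw [Matrix.mul_apply]
  have h : ∀ u : X → Fin n, (∀ x, x ∉ X → overwrite X s u x = t x) ↔ ∀ x, x ∉ X → s x = t x :=
    fun u => forall₂_congr fun x hx => by rw [overwrite_of_notMem s u hx]
  simp only [h]
  split_ifs <;> simp

open Classical in
lemma extendMatrix_mul_apply_of_disjoint (h : Disjoint X Y) (O : Matrix (X → Fin n) (X → Fin n) ℂ)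
    (P : Matrix (Y → Fin n) (Y → Fin n) ℂ) (s t : Site d L → Fin n) :
    (extendMatrix X O * extendMatrix Y P) s t
      = if ∀ x, x ∉ X → x ∉ Y → s x = t x then
          O (fun x => s x) (fun x => t x) * P (fun x => s x) (fun x => t x) else 0 := by
  rw [Matrix.mul_apply, extendMatrix_sum_eq O s (fun u => extendMatrix Y P u t)]
  simp only [extendMatrix_apply]
  -- The only contributing intermediate configuration equals t on X and s elsewhere.
  rw [Finset.sum_eq_single (fun x : X => t x)]
  · have h1 : (∀ x, x ∉ Y → overwrite X s (fun x : X => t x) x = t x)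
        ↔ ∀ x, x ∉ X → x ∉ Y → s x = t x := by
      constructor
      · intro H x hx hy
        rw [← H x hy, overwrite_of_notMem _ _ hx]
      · intro H x hy
        by_cases hx : x ∈ X
        · simp [overwrite, hx]
        · rw [overwrite_of_notMem _ _ hx, H x hx hy]
    have h2 : (fun y : Y => overwrite X s (fun x : X => t x) y) = fun y : Y => s y := by
      funext y
      exact overwrite_of_notMem _ _ (Finset.disjoint_right.1 h y.2)
    rw [h2]
    simp only [h1]
    split_ifs <;> simp
  · intro u _ hu
    rw [if_neg, mul_zero]
    intro H
    apply hu
    funext x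
    rw [← H x (Finset.disjoint_left.1 h x.2)]
    simp [overwrite]
  · intro H; exact absurd (Finset.mem_univ _) H

lemma extendMatrix_comm_of_disjoint (h : Disjoint X Y) (O : Matrix (X → Fin n) (X → Fin n) ℂ)
    (P : Matrix (Y → Fin n) (Y → Fin n) ℂ) :
    extendMatrix X O * extendMatrix Y P = extendMatrix Y P * extendMatrix X O := by
  ext s t
  rw [extendMatrix_mul_apply_of_disjoint h, extendMatrix_mul_apply_of_disjoint h.symm]
  simp only [mul_comm (O _ _)]
  congr 1
  exact propext ⟨fun H x h1 h2 => H x h2 h1, fun H x h1 h2 => H x h2 h1⟩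

open Classical in
lemma exists_extendMatrix_eq_of_subset (h : X ⊆ Y) (O : Matrix (X → Fin n) (X → Fin n) ℂ) :
    ∃ P : Matrix (Y → Fin n) (Y → Fin n) ℂ, extendMatrix Y P = extendMatrix X O := by
  -- The witness is O tensored with the identity on Y \ X.
  refine ⟨Matrix.of fun s t => if ∀ y : Y, (y : Site d L) ∉ X → s y = t y then
    O (fun x => s ⟨x, h x.2⟩) (fun x => t ⟨x, h x.2⟩) else 0, ?_⟩
  ext s t
  simp only [extendMatrix_apply, Matrix.of_apply]
  by_cases H : ∀ x, x ∉ X → s x = t x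
  · rw [if_pos H, if_pos (fun x hx => H x fun hx' => hx (h hx'))]
    exact if_pos fun (y : Y) hy => H y hy
  · rw [if_neg H]
    split_ifs with h1 h2
    · refine absurd (fun x hx => ?_) H
      by_cases hy : x ∈ Y
      · exact h2 ⟨x, hy⟩ hx
      · exact h1 x hy
    · rfl
    · rfl

/-- The observables of a spin system supported in `X`, as a subalgebra. -/
def spinLocalSubalgebra (n : ℕ) (X : Finset (Site d L)) :
    Subalgebra ℂ (OpOn (Site d L → Fin n)) where
  carrier := spinLocal X
  mul_mem' := by
    rintro _ _ ⟨O, rfl⟩ ⟨P, rfl⟩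
    exact ⟨O * P, by rw [extendMatrix_mul, ofMatrix_mul]⟩
  add_mem' := by
    rintro _ _ ⟨O, rfl⟩ ⟨P, rfl⟩
    exact ⟨O + P, by rw [extendMatrix_add]; exact (map_add _ _ _).symm⟩
  algebraMap_mem' := fun c => ⟨c • 1, by
    rw [extendMatrix_smul, extendMatrix_one, Algebra.algebraMap_eq_smul_one]
    exact ((map_smul _ _ _).trans (congrArg _ (map_one _))).symm⟩

end Spin

section Fermion

variable {d n : ℕ} {L : EvenSize} {X Y : Finset (Site d L)}

/-- The Jordan–Wigner sign of the mode `m` in the configuration `t`. -/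
noncomputable def modeSign (m : Site d L × Fin n) (t : Finset (Site d L × Fin n)) : ℂ :=
  (-1) ^ (t.filter fun m' => modeRank m' < modeRank m).card

lemma modeRank_injective : Function.Injective (modeRank : Site d L × Fin n → ℕ) :=
  fun _ _ h => (Fintype.equivFin (Site d L × Fin n)).injective (Fin.ext h)

lemma modeSign_insert (m k : Site d L × Fin n) {t : Finset (Site d L × Fin n)} (hk : k ∉ t) :
    modeSign m (insert k t) = (if modeRank k < modeRank m then -1 else 1) * modeSign m t := by
  rw [modeSign, Finset.filter_insert]
  split_ifs with h
  · rw [Finset.card_insert_of_notMem (by simp [hk]), pow_succ, modeSign]; ring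
  · rw [one_mul, modeSign]

lemma modeSign_erase (m k : Site d L × Fin n) {t : Finset (Site d L × Fin n)} (hk : k ∈ t) :
    modeSign m (t.erase k) = (if modeRank k < modeRank m then -1 else 1) * modeSign m t := by
  have h := modeSign_insert m k (t.notMem_erase k)
  rw [Finset.insert_erase hk] at h
  rw [h]
  split_ifs <;> ring

lemma annih_apply (m : Site d L × Fin n)
    (ψ : EuclideanSpace ℂ (Finset (Site d L × Fin n))) (s : Finset (Site d L × Fin n)) :
    annih m ψ s = if m ∈ s then 0 else modeSign m s * ψ (insert m s) := by
  rw [annih, ofMatrix_apply]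
  simp only [Matrix.of_apply]
  split_ifs with h
  · refine Finset.sum_eq_zero fun t _ => ?_
    rw [if_neg, zero_mul]
    rintro ⟨_, rfl⟩
    exact t.notMem_erase m h
  · rw [Finset.sum_eq_single (insert m s)]
    · rw [if_pos ⟨Finset.mem_insert_self _ _, (Finset.erase_insert h).symm⟩]
      congr 1
      have := modeSign_insert m m h
      rw [if_neg (lt_irrefl _), one_mul] at this
      exact this
    · intro t _ ht
      rw [if_neg, zero_mul]
      rintro ⟨h1, rfl⟩
      exact ht (Finset.insert_erase h1).symm
    · intro H; exact absurd (Finset.mem_univ _) H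

lemma star_annih_apply (m : Site d L × Fin n)
    (ψ : EuclideanSpace ℂ (Finset (Site d L × Fin n))) (s : Finset (Site d L × Fin n)) :
    star (annih m) ψ s = if m ∈ s then modeSign m s * ψ (s.erase m) else 0 := by
  rw [annih, ← ofMatrix_star, ofMatrix_apply]
  simp only [Matrix.star_apply, Matrix.of_apply]
  split_ifs with h
  · rw [Finset.sum_eq_single (s.erase m)]
    · rw [if_pos ⟨h, rfl⟩, star_pow, star_neg, star_one, modeSign]
    · intro t _ ht
      rw [if_neg, star_zero, zero_mul]
      rintro ⟨_, rfl⟩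
      exact ht rfl
    · intro H; exact absurd (Finset.mem_univ _) H
  · refine Finset.sum_eq_zero fun t _ => ?_
    rw [if_neg, star_zero, zero_mul]
    rintro ⟨h1, _⟩
    exact h h1

/-- Exactly one of two distinct modes precedes the other, so exactly one of the two orders acquires
an extra Jordan–Wigner sign. -/
lemma annih_mul_annih {m k : Site d L × Fin n} (h : m ≠ k) :
    annih m * annih k = -(annih k * annih m) := by
  refine ContinuousLinearMap.ext fun ψ => ?_
  ext s
  change annih m (annih k ψ) s = -(annih k (annih m ψ) s)
  have hr : modeRank m ≠ modeRank k := fun e => h (modeRank_injective e)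
  rw [annih_apply, annih_apply, annih_apply, annih_apply]
  by_cases hm : m ∈ s <;> by_cases hk : k ∈ s <;> simp only [hm, hk, Finset.mem_insert, h, h.symm,
    or_true, or_false, if_true, if_false, mul_zero, neg_zero]
  rw [modeSign_insert k m hm, modeSign_insert m k hk, Finset.insert_comm]
  rcases lt_or_gt_of_ne hr with h1 | h1
  · rw [if_pos h1, if_neg (not_lt.2 h1.le)]; ring
  · rw [if_pos h1, if_neg (not_lt.2 h1.le)]; ring

lemma annih_mul_star_annih {m k : Site d L × Fin n} (h : m ≠ k) :
    annih m * star (annih k) = -(star (annih k) * annih m) := by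
  refine ContinuousLinearMap.ext fun ψ => ?_
  ext s
  change annih m (star (annih k) ψ) s = -(star (annih k) (annih m ψ) s)
  have hr : modeRank m ≠ modeRank k := fun e => h (modeRank_injective e)
  rw [annih_apply, star_annih_apply, star_annih_apply, annih_apply]
  by_cases hm : m ∈ s <;> by_cases hk : k ∈ s <;> simp only [hm, hk, Finset.mem_insert,
    Finset.mem_erase, h, h.symm, ne_eq, not_false_eq_true, true_and,
    or_true, or_false, if_true, if_false, mul_zero, neg_zero]
  rw [modeSign_insert k m hm, modeSign_erase m k hk, Finset.erase_insert_of_ne h]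
  rcases lt_or_gt_of_ne hr with h1 | h1
  · rw [if_pos h1, if_neg (not_lt.2 h1.le)]; ring
  · rw [if_pos h1, if_neg (not_lt.2 h1.le)]; ring

lemma star_mul_star_of_anticommute {H : Type*} [NormedAddCommGroup H] [InnerProductSpace ℂ H]
    [CompleteSpace H] {a b : H →L[ℂ] H}
    (h : a * b = -(b * a)) : star b * star a = -(star a * star b) := by
  rw [← star_mul, ← star_mul, h, star_neg]

lemma ladder_anticommute (h : Disjoint X Y) {a b : OpOn (Finset (Site d L × Fin n))}
    (ha : a ∈ ladder X) (hb : b ∈ ladder Y) : b * a = -(a * b) := by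
  obtain ⟨m, hm, ha⟩ := ha
  obtain ⟨k, hk, hb⟩ := hb
  have hne : m ≠ k := fun e => Finset.disjoint_left.1 h hm (e ▸ hk)
  rcases ha with rfl | rfl <;> rcases hb with rfl | rfl
  · exact annih_mul_annih hne.symm
  · rw [annih_mul_star_annih hne, neg_neg]
  · exact annih_mul_star_annih hne.symm
  · exact star_mul_star_of_anticommute (annih_mul_annih hne)

lemma mul_prod_of_anticommute {R : Type*} [Ring R] (b : R) :
    ∀ l : List R, (∀ a ∈ l, b * a = -(a * b)) → b * l.prod = (-1) ^ l.length * (l.prod * b)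
  | [], _ => by simp
  | a :: l, h => by
    have ih := mul_prod_of_anticommute b l fun x hx => h x (List.mem_cons_of_mem _ hx)
    have h1 := h a List.mem_cons_self
    have hc : Commute a ((-1 : R) ^ l.length) :=
      ((Commute.one_right a).neg_right).pow_right _
    calc b * (a :: l).prod = b * a * l.prod := by rw [List.prod_cons, mul_assoc]
      _ = -(a * (b * l.prod)) := by rw [h1, neg_mul, mul_assoc]
      _ = -(a * (-1) ^ l.length * (l.prod * b)) := by rw [ih, mul_assoc]
      _ = _ := by
        rw [hc.eq, List.length_cons, pow_succ, List.prod_cons]; noncomm_ring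

lemma commute_prod_of_anticommute {R : Type*} [Ring R] {b : R} {l : List R}
    (h : ∀ a ∈ l, b * a = -(a * b)) (hl : Even l.length) : Commute b l.prod := by
  have := mul_prod_of_anticommute b l h
  rwa [hl.neg_one_pow, one_mul] at this

lemma star_list_prod {R : Type*} [Monoid R] [StarMul R] :
    ∀ l : List R, star l.prod = (l.map star).reverse.prod
  | [] => by simp
  | a :: l => by simp [star_list_prod l]

lemma star_mem_adjoin {R : Type*} [Ring R] [StarRing R] [Algebra ℂ R] [StarModule ℂ R] {s : Set R}
    (hs : ∀ a ∈ s, star a ∈ s) {a : R} (ha : a ∈ Algebra.adjoin ℂ s) :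
    star a ∈ Algebra.adjoin ℂ s := by
  induction ha using Algebra.adjoin_induction with
  | mem a ha => exact Algebra.subset_adjoin (hs a ha)
  | algebraMap c =>
    rw [← algebraMap_star_comm]
    exact Subalgebra.algebraMap_mem _ _
  | add a b _ _ ha hb => rw [star_add]; exact Subalgebra.add_mem _ ha hb
  | mul a b _ _ ha hb => rw [star_mul]; exact Subalgebra.mul_mem _ hb ha

/-- It suffices to compare words. A ladder operator of Y passing through an even word in X picks up
an even number of signs, so it commutes with that word, and so do products of such operators. -/
lemma fermionLocal_commute (h : Disjoint X Y) {A B : OpOn (Finset (Site d L × Fin n))}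
    (hA : A ∈ fermionLocal X) (hB : B ∈ fermionLocal Y) : Commute A B := by
  refine Algebra.commute_of_mem_adjoin_of_forall_mem_commute hB ?_
  rintro _ ⟨l, hl, _, rfl⟩
  refine (Algebra.commute_of_mem_adjoin_of_forall_mem_commute hA ?_).symm
  rintro _ ⟨k, hk, hke, rfl⟩
  refine (Commute.list_prod_right _ _ fun b hb => ?_).symm
  exact (commute_prod_of_anticommute
    (fun a ha => ladder_anticommute h (hk a ha) (hl b hb)) hke).symm

lemma ladder_mono (h : X ⊆ Y) :
    (ladder X : Set (OpOn (Finset (Site d L × Fin n)))) ⊆ ladder Y := by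
  rintro _ ⟨m, hm, ha⟩
  exact ⟨m, h hm, ha⟩

lemma fermionLocal_mono (h : X ⊆ Y) :
    (fermionLocal X : Set (OpOn (Finset (Site d L × Fin n)))) ⊆ fermionLocal Y := by
  refine Algebra.adjoin_mono ?_
  rintro _ ⟨l, hl, he, rfl⟩
  exact ⟨l, fun a ha => ladder_mono h (hl a ha), he, rfl⟩

lemma star_mem_ladder {a : OpOn (Finset (Site d L × Fin n))} (h : a ∈ ladder X) :
    star a ∈ ladder X := by
  obtain ⟨m, hm, rfl | rfl⟩ := h
  · exact ⟨m, hm, Or.inr rfl⟩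
  · exact ⟨m, hm, Or.inl (star_star _)⟩

lemma star_mem_fermionLocal {A : OpOn (Finset (Site d L × Fin n))} (hA : A ∈ fermionLocal X) :
    star A ∈ fermionLocal X := by
  refine star_mem_adjoin ?_ hA
  rintro _ ⟨l, hl, he, rfl⟩
  refine ⟨(l.map star).reverse, ?_, by simpa using he, star_list_prod l⟩
  intro a ha
  simp only [List.mem_reverse, List.mem_map] at ha
  obtain ⟨b, hb, rfl⟩ := ha
  exact star_mem_ladder (hl b hb)

/-- The even fermionic observables supported in `X`, as a subalgebra. -/
noncomputable def fermionLocalSubalgebra (n : ℕ) (X : Finset (Site d L)) :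
    Subalgebra ℂ (OpOn (Finset (Site d L × Fin n))) :=
  Algebra.adjoin ℂ {B | ∃ l : List (OpOn (Finset (Site d L × Fin n))),
    (∀ a ∈ l, a ∈ ladder X) ∧ Even l.length ∧ B = l.prod}

end Fermion

section LocalAlgebras

/-- The observables supported in `X`, as a subalgebra. -/
noncomputable def localSubalgebra : (K : SystemKind) → {d : ℕ} → (n : ℕ) → {L : EvenSize} → Finset (Site d L) →
    Subalgebra ℂ (Op K d n L)
  | .spin, _, n, _, X => spinLocalSubalgebra n X
  | .fermion, _, n, _, X => fermionLocalSubalgebra n X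

variable {K : SystemKind} {d n : ℕ} {L : EvenSize} {X Y : Finset (Site d L)}

lemma mem_localSubalgebra {A : Op K d n L} : A ∈ localSubalgebra K n X ↔ A ∈ localAlg K X := by
  cases K <;> exact Iff.rfl

lemma isClosed_localSubalgebra : IsClosed (localSubalgebra K n X : Set (Op K d n L)) :=
  Submodule.closed_of_finiteDimensional (Subalgebra.toSubmodule (localSubalgebra K n X))

lemma localAlg_mono (h : X ⊆ Y) {A : Op K d n L} (hA : A ∈ localAlg K X) : A ∈ localAlg K Y := by
  cases K with
  | spin =>
    obtain ⟨O, rfl⟩ := hA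
    obtain ⟨P, hP⟩ := exists_extendMatrix_eq_of_subset h O
    exact ⟨P, by rw [hP]⟩
  | fermion => exact fermionLocal_mono h hA

lemma localAlg_commute (h : Disjoint X Y) {A B : Op K d n L} (hA : A ∈ localAlg K X)
    (hB : B ∈ localAlg K Y) : Commute A B := by
  cases K with
  | spin =>
    obtain ⟨O, rfl⟩ := hA
    obtain ⟨P, rfl⟩ := hB
    have := congrArg ofMatrix (extendMatrix_comm_of_disjoint h O P)
    rwa [ofMatrix_mul, ofMatrix_mul] at this
  | fermion => exact fermionLocal_commute h hA hB

lemma star_mem_localAlg {A : Op K d n L} (hA : A ∈ localAlg K X) : star A ∈ localAlg K X := by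
  cases K with
  | spin =>
    obtain ⟨O, rfl⟩ := hA
    exact ⟨star O, by rw [extendMatrix_star, ofMatrix_star]⟩
  | fermion => exact star_mem_fermionLocal hA

end LocalAlgebras

end ManyBodyIndex

namespace ManyBodyIndex

/-! ### Distances in the first coordinate of the torus. -/

section TorusGeometry

variable {d : ℕ} {L : EvenSize}

lemma natAbs_valMinAbs_add_le_add {N : ℕ} (a b : ZMod N) :
    (a + b).valMinAbs.natAbs ≤ a.valMinAbs.natAbs + b.valMinAbs.natAbs :=
  (ZMod.natAbs_valMinAbs_add_le a b).trans (Int.natAbs_add_le _ _)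

lemma natAbs_valMinAbs_sub_le_add {N : ℕ} (a b c : ZMod N) :
    (a - c).valMinAbs.natAbs ≤ (a - b).valMinAbs.natAbs + (b - c).valMinAbs.natAbs := by
  have := natAbs_valMinAbs_add_le_add (a - b) (b - c)
  rwa [sub_add_sub_cancel] at this

lemma EvenSize.two_le (L : EvenSize) : 2 ≤ L.1 := by
  obtain ⟨L, hL, k, hk⟩ := L
  simp only; omega

lemma natAbs_valMinAbs_one_le : (1 : ZMod L.1).valMinAbs.natAbs ≤ 1 := by
  have h : ((1 : ℕ) : ZMod L.1).valMinAbs = (1 : ℕ) :=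
    ZMod.valMinAbs_natCast_of_le_half (by have := L.two_le; omega)
  rw [Nat.cast_one] at h
  rw [h]; simp

lemma natAbs_valMinAbs_single_le [NeZero d] (i : Fin d) :
    ((Pi.single i 1 : Site d L) 0).valMinAbs.natAbs ≤ 1 := by
  by_cases h : i = 0
  · subst h
    rw [Pi.single_eq_same]
    exact natAbs_valMinAbs_one_le
  · rw [Pi.single_eq_of_ne (Ne.symm h)]
    simp

lemma natAbs_valMinAbs_le_of_adj [NeZero d] {x y : Site d L} (h : (torusGraph d L).Adj x y) :
    (x 0 - y 0).valMinAbs.natAbs ≤ 1 := by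
  rcases h with ⟨_, ⟨i, h⟩ | ⟨i, h⟩⟩
  · rw [h, Pi.add_apply, sub_add_cancel_left, ZMod.natAbs_valMinAbs_neg]
    exact natAbs_valMinAbs_single_le i
  · rw [h, Pi.add_apply, add_sub_cancel_left]
    exact natAbs_valMinAbs_single_le i

lemma natAbs_valMinAbs_le_length [NeZero d] {x y : Site d L} (p : (torusGraph d L).Walk x y) :
    (x 0 - y 0).valMinAbs.natAbs ≤ p.length := by
  induction p with
  | nil => simp
  | @cons u v w h p ih =>
    have h1 := natAbs_valMinAbs_sub_le_add (u 0) (v 0) (w 0)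
    have h2 := natAbs_valMinAbs_le_of_adj h
    rw [SimpleGraph.Walk.length_cons]
    omega

lemma reachable_add_single (x : Site d L) (i : Fin d) :
    (torusGraph d L).Reachable x (x + Pi.single i 1) := by
  by_cases h : x = x + Pi.single i 1
  · rw [← h]
  · exact SimpleGraph.Adj.reachable ⟨h, Or.inl ⟨i, rfl⟩⟩

lemma reachable_add_single_natCast (x : Site d L) (i : Fin d) (k : ℕ) :
    (torusGraph d L).Reachable x (x + Pi.single i (k : ZMod L.1)) := by
  induction k with
  | zero => simp
  | succ k ih =>
    refine ih.trans ?_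
    rw [Nat.cast_succ, Pi.single_add, ← add_assoc]
    exact reachable_add_single _ i

/-- Connectedness matters because `SimpleGraph.dist` is 0 between unreachable vertices, which would
make fattenings too large. -/
lemma torusGraph_reachable (x y : Site d L) : (torusGraph d L).Reachable x y := by
  have h : ∀ s : Finset (Fin d), ∀ v : Site d L,
      (torusGraph d L).Reachable x (x + ∑ i ∈ s, Pi.single i (v i)) := by
    intro s v
    induction s using Finset.induction_on with
    | empty => simp
    | insert i s hi ih =>
      rw [Finset.sum_insert hi, add_left_comm, add_comm]
      refine ih.trans ?_
      have := reachable_add_single_natCast (x + ∑ i ∈ s, Pi.single i (v i)) i (v i).val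
      rwa [ZMod.natCast_zmod_val] at this
  have := h Finset.univ (y - x)
  rwa [Finset.univ_sum_single, add_sub_cancel] at this

lemma natAbs_valMinAbs_le_dist [NeZero d] (x y : Site d L) :
    (x 0 - y 0).valMinAbs.natAbs ≤ (torusGraph d L).dist x y := by
  obtain ⟨p, hp⟩ := (torusGraph_reachable x y).exists_walk_length_eq_dist
  rw [← hp]
  exact natAbs_valMinAbs_le_length p

lemma exists_of_mem_fatten [NeZero d] {X : Finset (Site d L)} {r : ℝ} {x : Site d L}
    (h : x ∈ fatten X r) : ∃ y ∈ X, ((x 0 - y 0).valMinAbs.natAbs : ℝ) ≤ r := by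
  obtain ⟨_, y, hy, hr⟩ := Finset.mem_filter.1 h
  exact ⟨y, hy, le_trans (Nat.cast_le.2 (natAbs_valMinAbs_le_dist x y)) hr⟩

lemma mem_stripMinus_iff [NeZero d] {x : Site d L} :
    x ∈ stripMinus d L ↔ ((x 0).valMinAbs.natAbs : ℝ) ≤ (L.1 : ℝ) / 8 := by
  rw [stripMinus, Finset.mem_filter, Nat.cast_natAbs, Int.cast_abs, abs_le]
  simp [coord]

lemma mem_stripPlus_iff [NeZero d] {x : Site d L} :
    x ∈ stripPlus d L
      ↔ ((x 0 - ((L.1 / 2 : ℕ) : ZMod L.1)).valMinAbs.natAbs : ℝ) ≤ (L.1 : ℝ) / 8 := by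
  rw [stripPlus, Finset.mem_filter, Nat.cast_natAbs, Int.cast_abs, abs_le]
  simp

lemma fatten_fatten_bdryMinus_subset [NeZero d] {r : ℝ} (hr : r ≤ (L.1 : ℝ) / 16) :
    fatten (fatten (bdryMinus d L) ((L.1 : ℝ) / 16)) r ⊆ stripMinus d L := by
  intro x hx
  obtain ⟨y, hy, hxy⟩ := exists_of_mem_fatten hx
  obtain ⟨z, hz, hyz⟩ := exists_of_mem_fatten hy
  have hz0 : z 0 = 0 := (ZMod.valMinAbs_eq_zero _).1 (Finset.mem_filter.1 hz).2
  rw [mem_stripMinus_iff]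
  have h := natAbs_valMinAbs_sub_le_add (x 0) (y 0) (z 0)
  rw [hz0, sub_zero, sub_zero] at h
  rw [hz0, sub_zero] at hyz
  have h' : ((x 0).valMinAbs.natAbs : ℝ)
      ≤ (x 0 - y 0).valMinAbs.natAbs + (y 0).valMinAbs.natAbs := by exact_mod_cast h
  linarith

lemma EvenSize.cast_half (L : EvenSize) : ((L.1 / 2 : ℕ) : ℝ) = (L.1 : ℝ) / 2 :=
  Nat.cast_div_charZero L.2.2.two_dvd

/-- The right boundary is at L/2 − 1 while the strip is centred at L/2; this offset is the extra 1
in the hypothesis. -/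
lemma fatten_fatten_bdryPlus_subset [NeZero d] {r : ℝ} (hr : r + 1 ≤ (L.1 : ℝ) / 16) :
    fatten (fatten (bdryPlus d L) ((L.1 : ℝ) / 16)) r ⊆ stripPlus d L := by
  intro x hx
  obtain ⟨y, hy, hxy⟩ := exists_of_mem_fatten hx
  obtain ⟨z, hz, hyz⟩ := exists_of_mem_fatten hy
  have hzc : (coord z : ℝ) = (L.1 : ℝ) / 2 - 1 := (Finset.mem_filter.1 hz).2
  have hz0 : z 0 - ((L.1 / 2 : ℕ) : ZMod L.1) = -1 := by
    have h1 : (z 0).valMinAbs = ((L.1 / 2 : ℕ) : ℤ) - 1 := by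
      have : ((z 0).valMinAbs : ℝ) = (((L.1 / 2 : ℕ) : ℤ) - 1 : ℤ) := by
        rw [Int.cast_sub, Int.cast_natCast, Int.cast_one, L.cast_half]
        exact hzc
      exact_mod_cast this
    have h2 := ZMod.coe_valMinAbs (z 0)
    rw [← h2, h1, Int.cast_sub, Int.cast_natCast, Int.cast_one]
    ring
  rw [mem_stripPlus_iff]
  have h := natAbs_valMinAbs_sub_le_add (x 0) (y 0) ((L.1 / 2 : ℕ) : ZMod L.1)
  have h1 := natAbs_valMinAbs_sub_le_add (y 0) (z 0) ((L.1 / 2 : ℕ) : ZMod L.1)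
  have h2 : (-1 : ZMod L.1).valMinAbs.natAbs ≤ 1 := by
    rw [ZMod.natAbs_valMinAbs_neg]; exact natAbs_valMinAbs_one_le
  rw [hz0] at h1
  have h3 : ((x 0 - ((L.1 / 2 : ℕ) : ZMod L.1)).valMinAbs.natAbs : ℝ)
      ≤ (x 0 - y 0).valMinAbs.natAbs + ((y 0 - z 0).valMinAbs.natAbs + 1) := by
    exact_mod_cast h.trans (add_le_add_right (h1.trans (add_le_add_right h2 _)) _)
  linarith

/-- The strip centres are L/2 apart on the circle and each strip has half-width L/8. -/
lemma quarter_le_natAbs_of_mem_strips [NeZero d] {x y : Site d L} (hx : x ∈ stripMinus d L)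
    (hy : y ∈ stripPlus d L) : (L.1 : ℝ) / 4 ≤ ((x 0 - y 0).valMinAbs.natAbs : ℝ) := by
  rw [mem_stripMinus_iff] at hx
  rw [mem_stripPlus_iff] at hy
  have hh : ((L.1 / 2 : ℕ) : ZMod L.1).valMinAbs.natAbs = L.1 / 2 := by
    rw [ZMod.valMinAbs_natCast_of_le_half le_rfl, Int.natAbs_natCast]
  have e : ((L.1 / 2 : ℕ) : ZMod L.1)
      = x 0 + (-(x 0 - y 0) + -(y 0 - ((L.1 / 2 : ℕ) : ZMod L.1))) := by ring
  have h1 := natAbs_valMinAbs_add_le_add (x 0)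
    (-(x 0 - y 0) + -(y 0 - ((L.1 / 2 : ℕ) : ZMod L.1)))
  have h2 := natAbs_valMinAbs_add_le_add (-(x 0 - y 0))
    (-(y 0 - ((L.1 / 2 : ℕ) : ZMod L.1)))
  rw [← e, hh] at h1
  rw [ZMod.natAbs_valMinAbs_neg, ZMod.natAbs_valMinAbs_neg] at h2
  have h3 : ((L.1 / 2 : ℕ) : ℝ) ≤ (x 0).valMinAbs.natAbs + ((x 0 - y 0).valMinAbs.natAbs
      + (y 0 - ((L.1 / 2 : ℕ) : ZMod L.1)).valMinAbs.natAbs) := by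
    exact_mod_cast h1.trans (add_le_add_right h2 _)
  rw [L.cast_half] at h3
  linarith

lemma disjoint_strips [NeZero d] : Disjoint (stripMinus d L) (stripPlus d L) := by
  rw [Finset.disjoint_left]
  intro x hx hy
  have h := quarter_le_natAbs_of_mem_strips hx hy
  rw [sub_self, ZMod.valMinAbs_zero] at h
  have : (0 : ℝ) < L.1 := Nat.cast_pos.2 L.2.1
  simp at h
  linarith

lemma quarter_le_dist₁ [NeZero d] {X Y : Finset (Site d L)} (hX : X ⊆ stripMinus d L)
    (hY : Y ⊆ stripPlus d L) (hXn : X.Nonempty) (hYn : Y.Nonempty) :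
    (L.1 : ℝ) / 4 ≤ (dist₁ X Y : ℝ) := by
  have hne : {r : ℕ | ∃ x ∈ X, ∃ y ∈ Y, r = (x 0 - y 0).valMinAbs.natAbs}.Nonempty := by
    obtain ⟨x, hx⟩ := hXn
    obtain ⟨y, hy⟩ := hYn
    exact ⟨_, x, hx, y, hy, rfl⟩
  obtain ⟨x, hx, y, hy, h⟩ := Nat.sInf_mem hne
  rw [dist₁, h]
  exact quarter_le_natAbs_of_mem_strips (hX hx) (hY hy)

end TorusGeometry

/-! ### Calculus of rapidly decaying and volume-bounded families. -/

section Asymptotics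

lemma EvenSize.cast_pos (L : EvenSize) : (0 : ℝ) < L.1 := Nat.cast_pos.2 L.2.1

lemma EvenSize.one_le_cast (L : EvenSize) : (1 : ℝ) ≤ L.1 := Nat.one_le_cast.2 L.2.1

lemma EvenSize.finite_lt (N : ℕ) : {L : EvenSize | L.1 < N}.Finite :=
  Set.Finite.preimage (Subtype.val_injective.injOn) (Set.finite_lt_nat N)

/-- Only finitely many sizes lie below N; their values are absorbed into the constant. -/
lemma IsOInfty.of_eventually_le {f g : EvenSize → ℝ} (hg : IsOInfty g) (N : ℕ)
    (h : ∀ L : EvenSize, N ≤ L.1 → |f L| ≤ |g L|) : IsOInfty f := by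
  intro k
  obtain ⟨C, hC⟩ := hg k
  set s := (EvenSize.finite_lt N).toFinset with hs
  have hsum : 0 ≤ ∑ L ∈ s, |f L| * (L.1 : ℝ) ^ k :=
    Finset.sum_nonneg fun L _ => by positivity
  refine ⟨C + ∑ L ∈ s, |f L| * (L.1 : ℝ) ^ k, fun L => ?_⟩
  have hL : (0 : ℝ) < (L.1 : ℝ) ^ k := pow_pos L.cast_pos k
  have hC0 : 0 ≤ C := by
    have := (abs_nonneg (g L)).trans (hC L)
    rw [le_div_iff₀ hL, zero_mul] at this
    exact this
  rw [le_div_iff₀ hL]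
  by_cases hN : N ≤ L.1
  · have h1 := (h L hN).trans (hC L)
    rw [le_div_iff₀ hL] at h1
    linarith
  · have hmem : L ∈ s := (EvenSize.finite_lt N).mem_toFinset.2 (not_le.1 hN)
    have := Finset.single_le_sum (f := fun L : EvenSize => |f L| * (L.1 : ℝ) ^ k)
      (fun L _ => by positivity) hmem
    linarith

lemma IsOInfty.add {f g : EvenSize → ℝ} (hf : IsOInfty f) (hg : IsOInfty g) :
    IsOInfty fun L => f L + g L := by
  intro k
  obtain ⟨C, hC⟩ := hf k
  obtain ⟨D, hD⟩ := hg k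
  refine ⟨C + D, fun L => ?_⟩
  rw [add_div]
  exact (abs_add_le _ _).trans (add_le_add (hC L) (hD L))

lemma IsOInfty.sqrt {f : EvenSize → ℝ} (hf : IsOInfty f) : IsOInfty fun L => √(f L) := by
  intro k
  obtain ⟨C, hC⟩ := hf (2 * k)
  refine ⟨√C, fun L => ?_⟩
  rw [abs_of_nonneg (Real.sqrt_nonneg _)]
  have hL : (0 : ℝ) ≤ (L.1 : ℝ) ^ k := (pow_pos L.cast_pos k).le
  calc √(f L) ≤ √(C / ((L.1 : ℝ) ^ k) ^ 2) := Real.sqrt_le_sqrt (by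
        rw [← pow_mul, mul_comm k 2]; exact (le_abs_self _).trans (hC L))
    _ = √C / (L.1 : ℝ) ^ k := by rw [Real.sqrt_div' _ (sq_nonneg _), Real.sqrt_sq hL]

lemma card_site (d : ℕ) (L : EvenSize) : (Fintype.card (Site d L) : ℝ) = (L.1 : ℝ) ^ d := by
  simp [Site, ZMod.card]

lemma IsOInfty.mul_isOVolume {f g : EvenSize → ℝ} {d : ℕ} (hg : IsOVolume d g)
    (hf : IsOInfty f) : IsOInfty fun L => g L * f L := by
  intro k
  obtain ⟨C, hC⟩ := hg
  obtain ⟨D, hD⟩ := hf (d + k)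
  refine ⟨C * D, fun L => ?_⟩
  have h1 := hC L
  rw [card_site] at h1
  have hd : (0 : ℝ) < (L.1 : ℝ) ^ d := pow_pos L.cast_pos d
  have hk : (0 : ℝ) < (L.1 : ℝ) ^ k := pow_pos L.cast_pos k
  rw [abs_mul]
  calc |g L| * |f L| ≤ (C * (L.1 : ℝ) ^ d) * (D / (L.1 : ℝ) ^ (d + k)) :=
        mul_le_mul h1 (hD L) (abs_nonneg _) ((abs_nonneg _).trans h1)
    _ = C * D / (L.1 : ℝ) ^ k := by rw [pow_add]; field_simp

lemma isOVolume_card (d : ℕ) : IsOVolume d fun L => (Fintype.card (Site d L) : ℝ) :=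
  ⟨1, fun L => by rw [one_mul, Nat.abs_cast]⟩

lemma isOVolume_const (d : ℕ) (c : ℝ) : IsOVolume d fun _ => c :=
  ⟨|c|, fun L => by
    rw [card_site]
    exact le_mul_of_one_le_right (abs_nonneg c) (one_le_pow₀ L.one_le_cast)⟩

lemma IsOVolume.add {d : ℕ} {f g : EvenSize → ℝ} (hf : IsOVolume d f) (hg : IsOVolume d g) :
    IsOVolume d fun L => f L + g L := by
  obtain ⟨C, hC⟩ := hf
  obtain ⟨D, hD⟩ := hg
  refine ⟨C + D, fun L => ?_⟩
  rw [add_mul]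
  exact (abs_add_le _ _).trans (add_le_add (hC L) (hD L))

lemma isOInfty_exp_neg {c : ℝ} (hc : 0 < c) : IsOInfty fun L => Real.exp (-(c * L.1)) := by
  intro k
  refine ⟨k.factorial / c ^ k, fun L => ?_⟩
  have hL := L.cast_pos
  have h := Real.pow_div_factorial_le_exp (c * L.1) (by positivity) k
  rw [abs_of_pos (Real.exp_pos _), Real.exp_neg]
  have hk : (0 : ℝ) < k.factorial := Nat.cast_pos.2 k.factorial_pos
  calc (Real.exp (c * L.1))⁻¹ ≤ ((c * L.1) ^ k / k.factorial)⁻¹ :=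
        inv_anti₀ (by positivity) h
    _ = k.factorial / c ^ k / (L.1 : ℝ) ^ k := by rw [mul_pow, inv_div, div_div]

end Asymptotics

/-! ### Distance to the integers and integer charges. -/

section Integrality

/-- With s the signed distance to the nearest integer, the right side is 2|sin πs|, and Jordan's
inequality gives sin(π|s|) ≥ 2|s|. -/
lemma abs_sub_round_le (t : ℝ) :
    4 * |t - round t| ≤ ‖Complex.exp (2 * Real.pi * Complex.I * t) - 1‖ := by
  set s : ℝ := t - round t with hs
  have hs2 : |s| ≤ 1 / 2 := abs_sub_round t
  have e : Complex.exp (2 * Real.pi * Complex.I * t)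
      = Complex.exp (Complex.I * ((2 * Real.pi * s : ℝ) : ℂ)) := by
    rw [Complex.exp_eq_exp_iff_exists_int]
    exact ⟨round t, by rw [hs]; push_cast; ring⟩
  rw [e, Complex.norm_exp_I_mul_ofReal_sub_one, Real.norm_eq_abs, abs_mul, abs_two]
  have e2 : 2 * Real.pi * s / 2 = Real.pi * s := by ring
  rw [e2]
  have h0 : |Real.sin (Real.pi * s)| = |Real.sin (Real.pi * |s|)| := by
    rcases abs_cases s with ⟨h, _⟩ | ⟨h, _⟩ <;> rw [h]
    rw [mul_neg, Real.sin_neg, abs_neg]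
  have hpi := Real.pi_pos
  have h1 := Real.mul_le_sin (x := Real.pi * |s|) (by positivity) (by nlinarith)
  have h2 : 2 / Real.pi * (Real.pi * |s|) = 2 * |s| := by field_simp
  rw [h2] at h1
  rw [h0]
  linarith [le_abs_self (Real.sin (Real.pi * |s|))]

variable {H : Type*} [NormedAddCommGroup H] [InnerProductSpace ℂ H] [CompleteSpace H]

lemma flow_two_pi_eq_one_of_integral {A : H →L[ℂ] H} (hA : IsSelfAdjoint A)
    (h : spectrum ℂ A ⊆ Set.range ((↑) : ℤ → ℂ)) : flow A (2 * Real.pi) = 1 := by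
  set c : ℂ := ((2 * Real.pi : ℝ) : ℂ) * Complex.I with hc
  have hn : IsStarNormal A := hA.isStarNormal
  have hn' : IsStarNormal (c • A) := by
    refine ⟨?_⟩
    rw [star_smul, hA.star_eq]
    exact ((Commute.refl A).smul_left _).smul_right _
  rw [flow, ← hc, ← CFC.complex_exp_eq_normedSpace_exp hn', ← cfc_comp_smul c Complex.exp A]
  rw [cfc_congr (g := fun _ => (1 : ℂ)), cfc_const_one ℂ A]
  intro x hx
  obtain ⟨m, rfl⟩ := h hx
  simp only [smul_eq_mul]
  rw [Complex.exp_eq_one_iff]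
  exact ⟨m, by rw [hc]; push_cast; ring⟩

lemma flow_sum_eq_one {ι : Type*} (s : Finset ι) (f : ι → H →L[ℂ] H)
    (hc : ∀ x y, Commute (f x) (f y)) {t : ℝ} (h : ∀ x, flow (f x) t = 1) :
    flow (∑ x ∈ s, f x) t = 1 := by
  classical
  induction s using Finset.induction_on with
  | empty => simp [flow, NormedSpace.exp_zero]
  | insert a s ha ih =>
    rw [Finset.sum_insert ha, flow_add_of_commute (Commute.sum_right _ _ _ fun i _ => hc a i), h,
      ih, one_mul]

/-- The self-adjoint part approximates a self-adjoint operator at least as well. -/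
lemma norm_sub_selfAdjointPart_le {A R : H →L[ℂ] H} (hA : IsSelfAdjoint A) :
    ‖A - (2⁻¹ : ℂ) • (R + star R)‖ ≤ ‖A - R‖ := by
  have e : A - (2⁻¹ : ℂ) • (R + star R) = (2⁻¹ : ℂ) • ((A - R) + star (A - R)) := by
    rw [star_sub, hA.star_eq]
    have : A = (2⁻¹ : ℂ) • (A + A) := by
      rw [← two_smul ℂ A, smul_smul]; norm_num
    nth_rewrite 1 [this]
    rw [← smul_sub]
    congr 1
    abel
  rw [e, norm_smul]
  have h := norm_add_le (A - R) (star (A - R))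
  rw [norm_star] at h
  have : ‖(2⁻¹ : ℂ)‖ = 2⁻¹ := by norm_num
  rw [this]
  linarith

lemma isSelfAdjoint_selfAdjointPart (R : H →L[ℂ] H) :
    IsSelfAdjoint ((2⁻¹ : ℂ) • (R + star R)) := by
  rw [isSelfAdjoint_iff, star_smul, star_add, star_star, add_comm]
  simp

end Integrality

end ManyBodyIndex

namespace ManyBodyIndex

/-! ### From commuting site charges to the transport data. -/

section SingleTorus

variable {H : Type*} [NormedAddCommGroup H] [InnerProductSpace ℂ H] [CompleteSpace H]

lemma sum_eq_sum_sdiff_add_sum_inter_add_sum_inter {ι M : Type*} [DecidableEq ι]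
    [AddCommMonoid M] {A B : Finset ι} (h : Disjoint A B) (G : Finset ι) (f : ι → M) :
    ∑ x ∈ G, f x = ∑ x ∈ G \ (A ∪ B), f x + ∑ x ∈ G ∩ A, f x + ∑ x ∈ G ∩ B, f x := by
  rw [add_assoc, ← Finset.sum_union (h.mono Finset.inter_subset_right Finset.inter_subset_right),
    ← Finset.inter_union_distrib_left, add_comm, Finset.sum_inter_add_sum_sdiff]

/-- Quantization of the transported charge for a charge that is a sum of commuting integer
charges, with an explicit error. -/
theorem four_mul_abs_sub_round_le {ι : Type*} [DecidableEq ι] (𝒜 ℬ : Subalgebra ℂ (H →L[ℂ] H))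
    (h𝒜 : IsClosed (𝒜 : Set (H →L[ℂ] H))) (hℬ : IsClosed (ℬ : Set (H →L[ℂ] H)))
    (hcomm : ∀ a ∈ 𝒜, ∀ b ∈ ℬ, Commute a b)
    (q : ι → H →L[ℂ] H) (G A B : Finset ι) (hAB : Disjoint A B)
    (hqq : ∀ x y, Commute (q x) (q y))
    (hqA : ∀ x ∈ A, q x ∈ 𝒜) (hqB : ∀ x ∈ B, q x ∈ ℬ)
    (hqA' : ∀ x, x ∉ A → ∀ a ∈ 𝒜, Commute (q x) a)
    (hqB' : ∀ x, x ∉ B → ∀ b ∈ ℬ, Commute (q x) b)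
    (hqs : ∀ x, IsSelfAdjoint (q x)) (hqi : ∀ x, spectrum ℂ (q x) ⊆ Set.range ((↑) : ℤ → ℂ))
    {Q : H →L[ℂ] H} (hQ : Q = ∑ x ∈ G, q x)
    {Tm Tp Km Kp Rm Rp U : H →L[ℂ] H}
    (hTm : Tm ∈ 𝒜) (hTp : Tp ∈ ℬ) (hKm : Km ∈ 𝒜) (hKp : Kp ∈ ℬ)
    (hRm : Rm ∈ 𝒜) (hRm' : star Rm ∈ 𝒜) (hRp : Rp ∈ ℬ) (hRp' : star Rp ∈ ℬ)
    (sTm : IsSelfAdjoint Tm) (sTp : IsSelfAdjoint Tp)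
    (sKm : IsSelfAdjoint Km) (sKp : IsSelfAdjoint Kp)
    (hU : U ∈ unitary (H →L[ℂ] H)) {Ω : H} (hΩ : ‖Ω‖ = 1) {ε : ℝ} (hε : ε ≤ 1)
    (htr : ‖star U * Q * U - Q - Tm - Tp‖ ≤ ε)
    (hm : ‖star U * Km * U - Rm‖ ≤ ε) (hp : ‖star U * Kp * U - Rp‖ ≤ ε)
    (hinv : ‖U Ω - (inner ℂ Ω (U Ω) : ℂ) • Ω‖ ≤ ε)
    (hfl : ‖(Q - Km - Kp) Ω - (inner ℂ Ω ((Q - Km - Kp) Ω) : ℂ) • Ω‖ ≤ ε)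
    (hcl : ∀ a ∈ 𝒜, ∀ b ∈ ℬ,
      ‖inner ℂ Ω ((a * b) Ω) - inner ℂ Ω (a Ω) * inner ℂ Ω (b Ω)‖ ≤ ε * ‖a‖ * ‖b‖)
    (hexp : ‖NormedSpace.exp ((2 * (Real.pi : ℂ) * Complex.I) • (Q + Tm)) - 1‖ ≤ ε) :
    4 * |(inner ℂ Ω (Tm Ω) : ℂ).re - round (inner ℂ Ω (Tm Ω) : ℂ).re|
      ≤ 600 * (2 + ‖Tm‖ + ‖Km‖) * √ε := by
  have hε0 : 0 ≤ ε := (norm_nonneg _).trans htr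
  have hUn : ‖U‖ ≤ 1 := norm_le_one_of_mem_unitary hU
  have hUn' : ‖star U‖ ≤ 1 := by rwa [norm_star]
  have hsum := (sum_eq_sum_sdiff_add_sum_inter_add_sum_inter hAB G q)
  rw [← hQ] at hsum
  have sQ : ∀ S : Finset ι, IsSelfAdjoint (∑ x ∈ S, q x) := fun S =>
    isSelfAdjoint_sum S fun x _ => hqs x
  have hper : ∀ S : Finset ι, flow (∑ x ∈ S, q x) (2 * Real.pi) = 1 := fun S =>
    flow_sum_eq_one S q hqq fun x => flow_two_pi_eq_one_of_integral (hqs x) (hqi x)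
  have sQbar : IsSelfAdjoint (Q - Km - Kp) := by
    rw [hQ]; exact ((sQ G).sub sKm).sub sKp
  have aKm := (norm_sub_selfAdjointPart_le (R := Rm) (sKm.conjugate' U)).trans hm
  have aKp := (norm_sub_selfAdjointPart_le (R := Rp) (sKp.conjugate' U)).trans hp
  let D : TransportData H :=
    { 𝒜 := 𝒜
      ℬ := ℬ
      isClosed_𝒜 := h𝒜
      isClosed_ℬ := hℬ
      commute := hcomm
      Q0 := ∑ x ∈ G \ (A ∪ B), q x
      Qm := ∑ x ∈ G ∩ A, q x
      Qp := ∑ x ∈ G ∩ B, q x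
      Tm := Tm
      Tp := Tp
      Km := Km
      Kp := Kp
      -- The local approximants need not be self-adjoint; their self-adjoint parts are no worse.
      Jm := (2⁻¹ : ℂ) • (Rm + star Rm)
      Jp := (2⁻¹ : ℂ) • (Rp + star Rp)
      U := U
      Q0_commute_𝒜 := fun a ha => Commute.sum_left _ _ _ fun x hx => hqA' x
        (fun h => (Finset.mem_sdiff.1 hx).2 (Finset.mem_union_left _ h)) a ha
      Q0_commute_ℬ := fun b hb => Commute.sum_left _ _ _ fun x hx => hqB' x
        (fun h => (Finset.mem_sdiff.1 hx).2 (Finset.mem_union_right _ h)) b hb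
      Qm_mem := 𝒜.sum_mem fun x hx => hqA x (Finset.mem_inter.1 hx).2
      Tm_mem := hTm
      Km_mem := hKm
      Jm_mem := 𝒜.smul_mem (𝒜.add_mem hRm hRm') _
      Qp_mem := ℬ.sum_mem fun x hx => hqB x (Finset.mem_inter.1 hx).2
      Tp_mem := hTp
      Kp_mem := hKp
      Jp_mem := ℬ.smul_mem (ℬ.add_mem hRp hRp') _
      Q0_sa := sQ _
      Qm_sa := sQ _
      Tm_sa := sTm
      Km_sa := sKm
      Jm_sa := isSelfAdjoint_selfAdjointPart Rm
      Qp_sa := sQ _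
      Tp_sa := sTp
      Kp_sa := sKp
      Jp_sa := isSelfAdjoint_selfAdjointPart Rp
      Q0_period := hper _
      Qm_period := hper _
      Qp_period := hper _
      U_unitary := hU
      Ω := Ω
      norm_Ω := hΩ
      ε := ε
      -- This leaves room for ‖`Jm`‖ ≤ ‖`Km`‖ + ε with ε ≤ 1.
      M := 2 + ‖Tm‖ + ‖Km‖
      lam := (inner ℂ Ω ((Q - Km - Kp) Ω) : ℂ).re
      u := inner ℂ Ω (U Ω)
      norm_u := (norm_expect_le hΩ).trans hUn
      ε_nonneg := hε0
      ε_le := hε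
      one_le_M := by linarith [norm_nonneg Tm, norm_nonneg Km]
      norm_Tm := by linarith [norm_nonneg Km]
      norm_Km := by linarith [norm_nonneg Tm]
      norm_Jm := by
        have h1 := norm_sub_norm_le ((2⁻¹ : ℂ) • (Rm + star Rm)) (star U * Km * U)
        rw [norm_sub_rev] at h1
        have h2 : ‖star U * Km * U‖ ≤ 1 * ‖Km‖ * 1 := by
          refine norm_mul₃_le.trans ?_
          gcongr
        linarith [norm_nonneg Tm]
      transport := by rw [← hsum]; exact htr
      approx_Km := aKm
      approx_Kp := aKp
      invariant := hinv
      fluctuation := by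
        rw [← hsum, TransportData.ofReal_re_expect sQbar]; exact hfl
      clustering := hcl
      period := by
        rw [← hsum, flow]
        push_cast
        exact hexp }
  exact (abs_sub_round_le _).trans D.norm_exp_expect_Tm_sub_one_le

end SingleTorus

/-! ### Uniform estimates over all sizes. -/

section Families

variable {K : SystemKind} {d n : ℕ}

lemma isOInfty_norm_of_variance {ψ : (L : EvenSize) → Hilb K d n L} {A : (L : EvenSize) → Op K d n L}
    (h : IsOInfty fun L => variance (ψ L) (A L)) :
    IsOInfty fun L => ‖A L (ψ L) - expect (ψ L) (A L) • ψ L‖ := by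
  have := h.sqrt
  simpa only [variance, Real.sqrt_sq (norm_nonneg _)] using this

lemma card_le_card_site {L : EvenSize} (X : Finset (Site d L)) :
    (X.card : ℝ) ≤ (Fintype.card (Site d L) : ℝ) :=
  Nat.cast_le.2 (Finset.card_le_univ X)

/-- Decay in the radius ⌊L/32⌋ becomes decay in L. The exponent d + d + k pays for two volume
factors: the norm of the observable and the size of its support. -/
lemma isOInfty_of_pow_mul_le {κ g : EvenSize → ℝ} {C : ℕ → ℝ} (hκ : ∀ L, 0 ≤ κ L)
    (hg : IsOVolume d g) (h : ∀ (L : EvenSize) (k : ℕ),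
      ((L.1 / 32 : ℕ) : ℝ) ^ k * κ L ≤ C k * (g L * (Fintype.card (Site d L) : ℝ))) :
    IsOInfty κ := by
  obtain ⟨D, hD⟩ := hg
  have hmain : IsOInfty fun L => if 32 ≤ L.1 then κ L else 0 := by
    intro k
    refine ⟨64 ^ (d + d + k) * (|C (d + d + k)| * |D|), fun L => ?_⟩
    have hL := L.cast_pos
    have hk : (0 : ℝ) < (L.1 : ℝ) ^ k := pow_pos hL k
    beta_reduce
    split_ifs with h32
    · rw [abs_of_nonneg (hκ L), le_div_iff₀ hk]
      -- The factor 64 instead of 32 absorbs the rounding down, valid once L ≥ 32.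
      have hr : (L.1 : ℝ) ≤ 64 * ((L.1 / 32 : ℕ) : ℝ) := by
        have : L.1 ≤ 64 * (L.1 / 32) := by omega
        exact_mod_cast this
      have h1 := h L (d + d + k)
      have h2 := hD L
      rw [card_site] at h1 h2
      have hv : (0 : ℝ) < (L.1 : ℝ) ^ d := pow_pos hL d
      have h3 : C (d + d + k) * (g L * (L.1 : ℝ) ^ d)
          ≤ |C (d + d + k)| * (|D| * (L.1 : ℝ) ^ d * (L.1 : ℝ) ^ d) := by
        refine (le_abs_self _).trans ?_
        rw [abs_mul, abs_mul, abs_of_pos hv]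
        gcongr
        refine h2.trans ?_
        gcongr
        exact le_abs_self D
      have h4 : (L.1 : ℝ) ^ (d + d + k)
          ≤ 64 ^ (d + d + k) * ((L.1 / 32 : ℕ) : ℝ) ^ (d + d + k) := by
        rw [← mul_pow]
        exact pow_le_pow_left₀ hL.le hr _
      have h5 := mul_le_mul_of_nonneg_right h4 (hκ L)
      have h6 : (0 : ℝ) ≤ 64 ^ (d + d + k) := by positivity
      have h7 := mul_le_mul_of_nonneg_left (h1.trans h3) h6
      have h8 : (κ L * (L.1 : ℝ) ^ k) * ((L.1 : ℝ) ^ d * (L.1 : ℝ) ^ d)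
          ≤ (64 ^ (d + d + k) * (|C (d + d + k)| * |D|))
            * ((L.1 : ℝ) ^ d * (L.1 : ℝ) ^ d) := by
        calc _ = (L.1 : ℝ) ^ (d + d + k) * κ L := by rw [pow_add, pow_add]; ring
          _ ≤ _ := h5
          _ = 64 ^ (d + d + k) * (((L.1 / 32 : ℕ) : ℝ) ^ (d + d + k) * κ L) := by ring
          _ ≤ _ := h7
          _ = _ := by ring
      exact le_of_mul_le_mul_right h8 (mul_pos hv hv)
    · rw [abs_zero]; positivity
  refine hmain.of_eventually_le 32 fun L hL => ?_
  rw [if_pos hL]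

/-- Observables near a boundary stay, up to small errors, near this boundary under conjugation
with an almost local unitary. -/
lemma exists_local_approx_conj {U : (L : EvenSize) → Op K d n L} (hU : IsAlmostLocalUnitary U)
    (X : (L : EvenSize) → Finset (Site d L)) {A : (L : EvenSize) → Op K d n L}
    (hA : ∀ L, A L ∈ localAlg K (X L)) (hAn : IsOVolume d fun L => ‖A L‖) :
    ∃ R : (L : EvenSize) → Op K d n L,
      (∀ L, R L ∈ localAlg K (fatten (X L) ((L.1 / 32 : ℕ) : ℝ))) ∧
      IsOInfty fun L => ‖star (U L) * A L * U L - R L‖ := by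
  obtain ⟨C, hC⟩ := hU.almostLocal
  -- The radius L/32 grows with L, yet added to the fattening L/16 it stays within the strip
  -- half-width L/8.
  choose R hR hRC using fun L => hC L (X L) (A L) (hA L) (L.1 / 32)
  refine ⟨R, hR, isOInfty_of_pow_mul_le (C := fun k => |C k|) (fun L => norm_nonneg _) hAn
    fun L k => (hRC L k).trans ?_⟩
  have h := card_le_card_site (X L)
  calc C k * (‖A L‖ * ((X L).card : ℝ)) ≤ |C k| * (‖A L‖ * ((X L).card : ℝ)) := by
        gcongr; exact le_abs_self _
    _ ≤ _ := by gcongr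

lemma norm_clustering_strips_le [NeZero d] {Ω : (L : EvenSize) → Hilb K d n L} {c C : ℝ} (hc : 0 < c)
    (hC : 0 < C) (h : ∀ (L : EvenSize) (X Y : Finset (Site d L)) (A B : Op K d n L),
      A ∈ localAlg K X → B ∈ localAlg K Y →
      ‖expect (Ω L) (A * B) - expect (Ω L) A * expect (Ω L) B‖ ≤
        C * ‖A‖ * ‖B‖ * (X.card : ℝ) * (Y.card : ℝ) * Real.exp (-c * (dist₁ X Y : ℝ)))
    (L : EvenSize) {A B : Op K d n L} (hA : A ∈ localAlg K (stripMinus d L))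
    (hB : B ∈ localAlg K (stripPlus d L)) :
    ‖expect (Ω L) (A * B) - expect (Ω L) A * expect (Ω L) B‖
      ≤ ((Fintype.card (Site d L) : ℝ) * ((Fintype.card (Site d L) : ℝ)
        * (C * Real.exp (-(c / 4 * L.1))))) * ‖A‖ * ‖B‖ := by
  refine (h L _ _ A B hA hB).trans ?_
  set X := stripMinus d L with hX
  set Y := stripPlus d L with hY
  -- For an empty region `dist₁` has the default value 0 and gives no decay, but the bound then
  -- vanishes through the cardinality.
  rcases X.eq_empty_or_nonempty with hXe | hXn
  · rw [hXe]; simp only [Finset.card_empty, Nat.cast_zero, mul_zero, zero_mul]; positivity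
  rcases Y.eq_empty_or_nonempty with hYe | hYn
  · rw [hYe]; simp only [Finset.card_empty, Nat.cast_zero, mul_zero, zero_mul]; positivity
  have hd := quarter_le_dist₁ hX.le hY.le hXn hYn
  have he : Real.exp (-c * (dist₁ X Y : ℝ)) ≤ Real.exp (-(c / 4 * L.1)) := by
    apply Real.exp_le_exp.2
    nlinarith
  have h1 := card_le_card_site X
  have h2 := card_le_card_site Y
  calc _ ≤ C * ‖A‖ * ‖B‖ * (Fintype.card (Site d L) : ℝ) * (Fintype.card (Site d L) : ℝ)
        * Real.exp (-(c / 4 * L.1)) := by gcongr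
    _ = _ := by ring

lemma IsOInfty.const_mul {f : EvenSize → ℝ} (hf : IsOInfty f) (c : ℝ) :
    IsOInfty fun L => c * f L :=
  IsOInfty.mul_isOVolume (isOVolume_const 0 c) hf

end Families

end ManyBodyIndex

/-! ### Assembly of the theorem. -/

theorem mainTheorem1 (K : SystemKind) (d n : ℕ) [NeZero d]
    (q : (L : EvenSize) → Site d L → Op K d n L) (hq : IsLocalCharge q)
    (U : (L : EvenSize) → Op K d n L) (hU : IsAlmostLocalUnitary U)
    (Ω : (L : EvenSize) → Hilb K d n L) (hΩ : ∀ L, ‖Ω L‖ = 1)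
    (hinv : IsOInfty fun L => variance (Ω L) (U L))
    (hfluct : HasLocalChargeFluctuations (halfCharge q) Ω)
    (hclust : IsClustering Ω)
    (Tm Tp : (L : EvenSize) → Op K d n L)
    (hT : IsTransportedCharge (halfCharge q) U Tm Tp)
    (hexp : IsOInfty fun L =>
      ‖NormedSpace.exp ((2 * (Real.pi : ℂ) * Complex.I) • (halfCharge q L + Tm L)) - 1‖)
    (hTm : IsOVolume d fun L => ‖Tm L‖) (hTp : IsOVolume d fun L => ‖Tp L‖) :
    ∃ ε : EvenSize → ℝ, IsOInfty ε ∧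
      ∀ L : EvenSize, ∃ m : ℤ, ‖expect (Ω L) (Tm L) - (m : ℂ)‖ ≤ ε L := by
  classical
  obtain ⟨Km, Kp, hKm, hKp, sKm, sKp, nKm, nKp, hvar⟩ := hfluct
  obtain ⟨c, C, hc, hC, hcl⟩ := hclust
  obtain ⟨Rm, hRm, oRm⟩ := exists_local_approx_conj hU _ hKm nKm
  obtain ⟨Rp, hRp, oRp⟩ := exists_local_approx_conj hU _ hKp nKp
  have oU := isOInfty_norm_of_variance hinv
  have oQ := isOInfty_norm_of_variance hvar
  have oγ : IsOInfty fun L : EvenSize => (Fintype.card (Site d L) : ℝ) *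
      ((Fintype.card (Site d L) : ℝ) * (C * Real.exp (-(c / 4 * L.1)))) :=
    IsOInfty.mul_isOVolume (isOVolume_card d) (IsOInfty.mul_isOVolume (isOVolume_card d)
      ((isOInfty_exp_neg (by positivity)).const_mul C))
  -- A single error dominating all the separate ones, as the one-torus estimate requires.
  have oE := (((((hT.approx.add oRm).add oRp).add oU).add oQ).add oγ).add hexp
  set E : EvenSize → ℝ := fun L => _ with hE
  have oF := IsOInfty.mul_isOVolume (((isOVolume_const d 2).add hTm).add nKm) oE.sqrt
  have oF' := oF.const_mul 600
  -- The error is the exact distance of the real part to the nearest integer; the expectation is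
  -- real since T₋ is self-adjoint.
  refine ⟨fun L => |(expect (Ω L) (Tm L)).re - round (expect (Ω L) (Tm L)).re|, ?_, fun L =>
    ⟨round (expect (Ω L) (Tm L)).re, ?_⟩⟩
  swap
  · have h := TransportData.ofReal_re_expect (hT.selfAdjoint_minus L) (Ω L)
    have h' : (((expect (Ω L) (Tm L)).re : ℝ) : ℂ) = expect (Ω L) (Tm L) := h
    refine le_of_eq ?_
    nth_rewrite 1 [← h']
    rw [← Complex.ofReal_intCast, ← Complex.ofReal_sub, Complex.norm_real, Real.norm_eq_abs]
  -- From L = 32 on, ⌊L/32⌋ + 1 ≤ L/16, so the approximants lie in the strips.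
  refine oF'.of_eventually_le 32 fun L hL => ?_
  rw [abs_abs]
  set γ : ℝ := (Fintype.card (Site d L) : ℝ) *
      ((Fintype.card (Site d L) : ℝ) * (C * Real.exp (-(c / 4 * L.1)))) with hγ
  have hγ0 : 0 ≤ γ := by positivity
  have n1 := norm_nonneg ((star (U L) * halfCharge q L * U L - halfCharge q L) - Tm L - Tp L)
  have n2 := norm_nonneg (star (U L) * Km L * U L - Rm L)
  have n3 := norm_nonneg (star (U L) * Kp L * U L - Rp L)
  have n4 := norm_nonneg (U L (Ω L) - expect (Ω L) (U L) • Ω L)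
  have n5 := norm_nonneg ((halfCharge q L - Km L - Kp L) (Ω L)
    - expect (Ω L) (halfCharge q L - Km L - Kp L) • Ω L)
  have n6 := norm_nonneg
    (NormedSpace.exp ((2 * (Real.pi : ℂ) * Complex.I) • (halfCharge q L + Tm L)) - 1)
  refine le_trans ?_ (le_abs_self _)
  have hEL : E L = ‖(star (U L) * halfCharge q L * U L - halfCharge q L) - Tm L - Tp L‖
      + ‖star (U L) * Km L * U L - Rm L‖ + ‖star (U L) * Kp L * U L - Rp L‖
      + ‖U L (Ω L) - expect (Ω L) (U L) • Ω L‖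
      + ‖(halfCharge q L - Km L - Kp L) (Ω L)
        - expect (Ω L) (halfCharge q L - Km L - Kp L) • Ω L‖ + γ
      + ‖NormedSpace.exp ((2 * (Real.pi : ℂ) * Complex.I) • (halfCharge q L + Tm L)) - 1‖ := rfl
  change _ ≤ 600 * ((2 + ‖Tm L‖ + ‖Km L‖) * √(E L))
  have nT := norm_nonneg (Tm L)
  have nK := norm_nonneg (Km L)
  rcases le_total (E L) 1 with hE1 | hE1
  swap
  -- When the error exceeds 1 the claim is trivial, because the distance to the nearest integer is
  -- at most 1/2.
  · have h1 : 1 ≤ √(E L) := Real.one_le_sqrt.2 hE1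
    have h2 := abs_sub_round (expect (Ω L) (Tm L)).re
    nlinarith
  have hr : ((L.1 / 32 : ℕ) : ℝ) + 1 ≤ (L.1 : ℝ) / 16 := by
    have h1 : ((L.1 / 32 : ℕ) : ℝ) ≤ (L.1 : ℝ) / 32 := Nat.cast_div_le
    have h2 : (32 : ℝ) ≤ L.1 := by exact_mod_cast hL
    linarith
  have hr0 : (0 : ℝ) ≤ ((L.1 / 32 : ℕ) : ℝ) := Nat.cast_nonneg _
  have hSm := fatten_fatten_bdryMinus_subset (d := d) (L := L) (r := ((L.1 / 32 : ℕ) : ℝ))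
    (by linarith)
  have hSp := fatten_fatten_bdryPlus_subset (d := d) (L := L) (r := ((L.1 / 32 : ℕ) : ℝ)) hr
  have subset_fatten : ∀ X : Finset (Site d L), X ⊆ fatten X ((L.1 / 32 : ℕ) : ℝ) :=
    fun X x hx => Finset.mem_filter.2 ⟨Finset.mem_univ _, x, hx, by simp⟩
  have hmain := four_mul_abs_sub_round_le (H := Hilb K d n L)
    (localSubalgebra K n (stripMinus d L)) (localSubalgebra K n (stripPlus d L))
    isClosed_localSubalgebra isClosed_localSubalgebra
    (fun a ha b hb => localAlg_commute disjoint_strips (mem_localSubalgebra.1 ha)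
      (mem_localSubalgebra.1 hb))
    (q L) (halfTorus d L) (stripMinus d L) (stripPlus d L) disjoint_strips
    (fun x y => by
      by_cases h : x = y
      · rw [h]
      · exact localAlg_commute (Finset.disjoint_singleton.2 h) (hq.mem L x) (hq.mem L y))
    (fun x hx => mem_localSubalgebra.2
      (localAlg_mono (Finset.singleton_subset_iff.2 hx) (hq.mem L x)))
    (fun x hx => mem_localSubalgebra.2
      (localAlg_mono (Finset.singleton_subset_iff.2 hx) (hq.mem L x)))
    (fun x hx a ha => localAlg_commute (Finset.disjoint_singleton_left.2 hx) (hq.mem L x)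
      (mem_localSubalgebra.1 ha))
    (fun x hx a ha => localAlg_commute (Finset.disjoint_singleton_left.2 hx) (hq.mem L x)
      (mem_localSubalgebra.1 ha))
    (hq.selfAdjoint L) (hq.integral L) (Q := halfCharge q L) rfl
    (mem_localSubalgebra.2 (hT.mem_minus L)) (mem_localSubalgebra.2 (hT.mem_plus L))
    (mem_localSubalgebra.2 (localAlg_mono ((subset_fatten _).trans hSm) (hKm L)))
    (mem_localSubalgebra.2 (localAlg_mono ((subset_fatten _).trans hSp) (hKp L)))
    (mem_localSubalgebra.2 (localAlg_mono hSm (hRm L)))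
    (mem_localSubalgebra.2 (localAlg_mono hSm (star_mem_localAlg (hRm L))))
    (mem_localSubalgebra.2 (localAlg_mono hSp (hRp L)))
    (mem_localSubalgebra.2 (localAlg_mono hSp (star_mem_localAlg (hRp L))))
    (hT.selfAdjoint_minus L) (hT.selfAdjoint_plus L) (sKm L) (sKp L) (hU.unitary L) (hΩ L)
    (ε := E L) hE1 (by rw [hEL]; linarith) (by rw [hEL]; linarith) (by rw [hEL]; linarith)
    (show ‖U L (Ω L) - expect (Ω L) (U L) • Ω L‖ ≤ E L by rw [hEL]; linarith)
    (show ‖(halfCharge q L - Km L - Kp L) (Ω L)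
      - expect (Ω L) (halfCharge q L - Km L - Kp L) • Ω L‖ ≤ E L by rw [hEL]; linarith)
    (fun a ha b hb => by
      refine (norm_clustering_strips_le hc hC hcl L (mem_localSubalgebra.1 ha)
        (mem_localSubalgebra.1 hb)).trans ?_
      have : γ ≤ E L := by rw [hEL]; linarith
      gcongr)
    (by rw [hEL]; linarith)
  have hfin : 4 * |(expect (Ω L) (Tm L)).re - round (expect (Ω L) (Tm L)).re|
      ≤ 600 * (2 + ‖Tm L‖ + ‖Km L‖) * √(E L) := hmain
  have := abs_nonneg ((expect (Ω L) (Tm L)).re - round (expect (Ω L) (Tm L)).re)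
  linarith
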